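/- Let $N\ge 3$. Let $V:(0,\infty)\to[0,\infty)$ and $K:(0,\infty)\to(0,\infty)$ be continuous, and suppose there is $C>0$ with $V(r)\le C/r^2$ for all $r\in(0,1)$. Let $f\in C^\infty(\mathbb R)$ be the unique solution of $f'(t)=1/\sqrt{1+2f(t)^2}$ on $\mathbb R$, $f(0)=0$. Let $D^{1,2}_r(\mathbb R^N)$ be the closure of the radial functions of $C_c^\infty(\mathbb R^N)$ in the norm $\|u\|_{1,2}=(\int_{\mathbb R^N}|\nabla u|^2dx)^{1/2}$ (as a space of functions in $L^{2N/(N-2)}(\mathbb R^N)$), and let $$E=\Big\{u\in D^{1,2}_r(\mathbb R^N):\int_{\mathbb R^N}V(|x|)f(u)^2dx<\infty\Big\},\qquad \|u\|=\|u\|_{1,2}+\inf_{k>0}\frac1k\Big[1+\int_{\mathbb R^N}V(|x|)f(ku)^2dx\Big].$$ Let $q_1,q_2>1$, and let $g:\mathbb R\to\mathbb R$ be continuous with $G(t)=\int_0^tg(s)\,ds$, such that - there is $\theta>2$ with $0\le 2\theta G(t)\le g(t)t$ for all $t\in\mathbb R$; - there is $t_0>0$ with $G(t_0)>0$; - there is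 $C>0$ with $|g(t)|\le C\min\{|t|^{q_1-1},|t|^{q_2-1}\}$ for all $t\in\mathbb R$. Assume that for some $R_1,R_2>0$ $$\sup_{u\in E,\ \|u\|=1}\int_{|x|<R_1}K(|x|)|u|^{q_1}dx<\infty,\qquad \sup_{u\in E,\ \|u\|=1}\int_{|x|\ge R_2}K(|x|)|u|^{q_2}dx<\infty.$$ Let $u\in E$ be a critical point (that is, a point where the Fréchet derivative is zero) of the functional $I:E\to\mathbb R$, $$I(u)=\frac12\int_{\mathbb R^N}|\nabla u|^2dx+\frac12\int_{\mathbb R^N}V(|x|)f(u)^2dx-\int_{\mathbb R^N}K(|x|)G(f(u))\,dx,$$ and set $w=f(u)$. Then $w\in C^2(\mathbb R^N\setminus\{0\})$ (after modification on a null set), and $w$ is a classical solution of $$-\Delta w+V(|x|)\,w-w\,\Delta(w^2)=K(|x|)\,g(w)\quad\text{in }\mathbb R^N\setminus\{0\}.$$ -/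

import Mathlib

open Set Filter Topology MeasureTheory
open scoped ENNReal Laplacian

noncomputable section

namespace QuasilinearDual

/-- `f` is a solution of the Cauchy problem `f' = 1 / √(1 + 2 f²)` on `ℝ`, `f 0 = 0`. -/
def SolvesCauchy (f : ℝ → ℝ) : Prop :=
  (∀ t : ℝ, HasDerivAt f (1 / √(1 + 2 * f t ^ 2)) t) ∧ f 0 = 0

theorem sqrt_pos' (s : ℝ) : 0 < √(1 + 2 * s ^ 2) := by positivity

theorem one_le_sqrt (s : ℝ) : 1 ≤ √(1 + 2 * s ^ 2) := by
  rw [Real.one_le_sqrt]; nlinarith [sq_nonneg s]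

/-- The inverse of the solution: a primitive of `√(1 + 2 s²)`. -/
def primitive (s : ℝ) : ℝ := ∫ τ in (0 : ℝ)..s, √(1 + 2 * τ ^ 2)

theorem hasDerivAt_primitive (s : ℝ) : HasDerivAt primitive (√(1 + 2 * s ^ 2)) s := by
  have hc : Continuous fun τ : ℝ => √(1 + 2 * τ ^ 2) := by fun_prop
  exact intervalIntegral.integral_hasDerivAt_right (hc.intervalIntegrable _ _)
    (hc.stronglyMeasurableAtFilter _ _) hc.continuousAt

theorem primitive_zero : primitive 0 = 0 := by simp [primitive]

theorem primitive_strictMono : StrictMono primitive :=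
  strictMono_of_hasDerivAt_pos hasDerivAt_primitive sqrt_pos'

theorem primitive_continuous : Continuous primitive :=
  continuous_iff_continuousAt.2 fun s => (hasDerivAt_primitive s).continuousAt

theorem primitive_sub_monotone : Monotone fun s => primitive s - s := by
  apply monotone_of_deriv_nonneg
  · exact fun s => ((hasDerivAt_primitive s).sub (hasDerivAt_id s)).differentiableAt
  · intro s
    have h : HasDerivAt (fun s => primitive s - s) (√(1 + 2 * s ^ 2) - 1) s :=
      (hasDerivAt_primitive s).sub (hasDerivAt_id s)
    rw [h.deriv]
    linarith [one_le_sqrt s]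

theorem primitive_surjective : Function.Surjective primitive := by
  apply primitive_continuous.surjective
  · refine tendsto_atTop_mono' _ ?_ tendsto_id
    filter_upwards [eventually_ge_atTop (0 : ℝ)] with s hs
    have := primitive_sub_monotone hs
    simp only [primitive_zero] at this
    simp only [id]; linarith
  · refine tendsto_atBot_mono' _ ?_ tendsto_id
    filter_upwards [eventually_le_atBot (0 : ℝ)] with s hs
    have := primitive_sub_monotone hs
    simp only [primitive_zero] at this
    simp only [id]; linarith

theorem existsUnique_solvesCauchy : ∃! f : ℝ → ℝ, SolvesCauchy f := by
  let e : ℝ ≃o ℝ :=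
    StrictMono.orderIsoOfSurjective primitive primitive_strictMono primitive_surjective
  have he : ∀ s, e s = primitive s := fun _ => rfl
  refine ⟨e.symm, ⟨fun t => ?_, ?_⟩, ?_⟩
  · have := HasDerivAt.of_local_left_inverse (f := primitive) (g := e.symm) (a := t)
      (e.symm.continuous.continuousAt) (hasDerivAt_primitive (e.symm t))
      (sqrt_pos' _).ne' (Eventually.of_forall fun y => e.apply_symm_apply y)
    rw [one_div]; exact this
  · rw [OrderIso.symm_apply_eq, he, primitive_zero]
  · rintro f ⟨hf, h0⟩
    have hd : ∀ t, HasDerivAt (fun t => primitive (f t) - t) 0 t := by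
      intro t
      have h := ((hasDerivAt_primitive (f t)).comp t (hf t)).sub (hasDerivAt_id t)
      have hz : √(1 + 2 * f t ^ 2) * (1 / √(1 + 2 * f t ^ 2)) - 1 = 0 := by
        rw [mul_one_div, div_self (sqrt_pos' _).ne', sub_self]
      rw [hz] at h
      exact h
    funext t
    have hc := is_const_of_deriv_eq_zero (fun t => (hd t).differentiableAt)
      (fun t => (hd t).deriv) t 0
    simp only [h0, primitive_zero, sub_zero] at hc
    rw [OrderIso.eq_symm_apply, he]
    linarith

/-- The change of variable `f`: the unique solution of the Cauchy problem. -/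
def f : ℝ → ℝ := existsUnique_solvesCauchy.choose

theorem f_solvesCauchy : SolvesCauchy f := existsUnique_solvesCauchy.choose_spec.1

/-- Hypothesis **(H)** on the potentials (only their values on `(0, ∞)` matter). -/
def HypH (V K : ℝ → ℝ) : Prop :=
  ContinuousOn V (Ioi 0) ∧ (∀ r, 0 < r → 0 ≤ V r) ∧
  ContinuousOn K (Ioi 0) ∧ (∀ r, 0 < r → 0 < K r) ∧
  ∃ C : ℝ, 0 < C ∧ ∀ r, 0 < r → r < 1 → V r ≤ C / r ^ 2

/-- `G(t) = ∫₀ᵗ g`. -/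
def primG (g : ℝ → ℝ) (t : ℝ) : ℝ := ∫ s in (0 : ℝ)..t, g s

/-- Hypothesis **(g₁)**. -/
def HypG1 (g : ℝ → ℝ) : Prop :=
  ∃ θ : ℝ, 2 < θ ∧ ∀ t : ℝ, 0 ≤ 2 * θ * primG g t ∧ 2 * θ * primG g t ≤ g t * t

/-- Hypothesis **(g₂)**. -/
def HypG2 (g : ℝ → ℝ) : Prop := ∃ t₀ : ℝ, 0 < t₀ ∧ 0 < primG g t₀

/-- The double-power growth condition. -/
def HypGq (g : ℝ → ℝ) (q₁ q₂ : ℝ) : Prop :=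
  ∃ C : ℝ, 0 < C ∧ ∀ t : ℝ, |g t| ≤ C * min (|t| ^ (q₁ - 1)) (|t| ^ (q₂ - 1))

variable {N : ℕ}

/-- Radial functions in `C_c^∞(ℝ^N)`. -/
def IsRadialTest (φ : EuclideanSpace ℝ (Fin N) → ℝ) : Prop :=
  ContDiff ℝ (⊤ : ℕ∞) φ ∧ HasCompactSupport φ ∧ ∀ x y, ‖x‖ = ‖y‖ → φ x = φ y

/-- `G` is a weak (distributional) gradient of `u` on `ℝ^N`. -/
def IsWeakGradient (u : EuclideanSpace ℝ (Fin N) → ℝ)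
    (G : EuclideanSpace ℝ (Fin N) → EuclideanSpace ℝ (Fin N)) : Prop :=
  LocallyIntegrable u ∧ LocallyIntegrable G ∧
  ∀ φ : EuclideanSpace ℝ (Fin N) → ℝ, ContDiff ℝ (⊤ : ℕ∞) φ → HasCompactSupport φ →
    ∫ x, u x • gradient φ x = -∫ x, φ x • G x

open Classical in
/-- The weak gradient `∇u` (almost everywhere unique when it exists). -/
def weakGrad (u : EuclideanSpace ℝ (Fin N) → ℝ) :
    EuclideanSpace ℝ (Fin N) → EuclideanSpace ℝ (Fin N) :=
  if h : ∃ G, IsWeakGradient u G then h.choose else 0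

/-- The critical Sobolev exponent `2* = 2N / (N - 2)` (used for `N ≥ 3`). -/
def critExp (N : ℕ) : ℝ≥0∞ := ENNReal.ofReal (2 * (N : ℝ) / ((N : ℝ) - 2))

/-- `u ∈ D_r^{1,2}(ℝ^N)`: the closure of the radial test functions in the norm `‖∇u‖_{L²}`,
realized for `N ≥ 3` as usual as a space of functions in `L^{2*}`: by the Sobolev inequality a
sequence of test functions that is Cauchy in this norm converges in `L^{2*}`, and the gradients
converge in `L²` to the weak gradient of the limit.  Functions here are representatives of their
almost-everywhere classes. -/
def MemD (u : EuclideanSpace ℝ (Fin N) → ℝ) : Prop :=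
  MemLp u (critExp N) ∧ (∃ G, IsWeakGradient u G) ∧ MemLp (weakGrad u) 2 ∧
  ∃ φ : ℕ → EuclideanSpace ℝ (Fin N) → ℝ, (∀ n, IsRadialTest (φ n)) ∧
    Tendsto (fun n => eLpNorm (fun x => φ n x - u x) (critExp N) volume) atTop (𝓝 0) ∧
    Tendsto (fun n => eLpNorm (fun x => gradient (φ n) x - weakGrad u x) 2 volume) atTop (𝓝 0)

/-- The modular `∫ V(|x|) f(u)² dx`, with values in `[0, ∞]`. -/
def modular (V : ℝ → ℝ) (u : EuclideanSpace ℝ (Fin N) → ℝ) : ℝ≥0∞ :=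
  ∫⁻ x, ENNReal.ofReal (V ‖x‖ * f (u x) ^ 2)

/-- Membership in the space `E`. -/
def MemE (V : ℝ → ℝ) (u : EuclideanSpace ℝ (Fin N) → ℝ) : Prop :=
  MemD u ∧ modular V u < ⊤

/-- `‖u‖_{1,2} = (∫ |∇u|² dx)^{1/2}`. -/
def normD (u : EuclideanSpace ℝ (Fin N) → ℝ) : ℝ := √(∫ x, ‖weakGrad u x‖ ^ 2)

/-- The Orlicz norm `‖u‖_o = inf_{k > 0} (1/k) (1 + ∫ V(|x|) f(ku)² dx)`, computed in `[0, ∞]`. -/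
def normO (V : ℝ → ℝ) (u : EuclideanSpace ℝ (Fin N) → ℝ) : ℝ :=
  (⨅ (k : ℝ) (_ : 0 < k), ENNReal.ofReal (1 / k) * (1 + modular V (fun x => k * u x))).toReal

/-- The norm of `E`. -/
def normE (V : ℝ → ℝ) (u : EuclideanSpace ℝ (Fin N) → ℝ) : ℝ := normD u + normO V u

/-- `𝒮₀(q, R) = sup { ∫_{B_R} K(|x|) |u|^q dx : u ∈ E, ‖u‖ = 1 }`, with values in `[0, ∞]`. -/
def S0 (N : ℕ) (V K : ℝ → ℝ) (q R : ℝ) : ℝ≥0∞ :=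
  ⨆ (u : EuclideanSpace ℝ (Fin N) → ℝ) (_ : MemE V u ∧ normE V u = 1),
    ∫⁻ x in Metric.ball 0 R, ENNReal.ofReal (K ‖x‖ * |u x| ^ q)

/-- `𝒮_∞(q, R) = sup { ∫_{ℝ^N ∖ B_R} K(|x|) |u|^q dx : u ∈ E, ‖u‖ = 1 }`. -/
def SInf (N : ℕ) (V K : ℝ → ℝ) (q R : ℝ) : ℝ≥0∞ :=
  ⨆ (u : EuclideanSpace ℝ (Fin N) → ℝ) (_ : MemE V u ∧ normE V u = 1),
    ∫⁻ x in (Metric.ball 0 R)ᶜ, ENNReal.ofReal (K ‖x‖ * |u x| ^ q)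

/-- Condition `(𝒮'_{q₁,q₂})`. -/
def CondS' (N : ℕ) (V K : ℝ → ℝ) (q₁ q₂ : ℝ) : Prop :=
  ∃ R₁ R₂ : ℝ, 0 < R₁ ∧ 0 < R₂ ∧ S0 N V K q₁ R₁ < ⊤ ∧ SInf N V K q₂ R₂ < ⊤

/-- The functional `I(u) = ½ ∫ |∇u|² + ½ ∫ V(|x|) f(u)² - ∫ K(|x|) G(f(u))`. -/
def energy (V K g : ℝ → ℝ) (u : EuclideanSpace ℝ (Fin N) → ℝ) : ℝ :=
  1 / 2 * (∫ x, ‖weakGrad u x‖ ^ 2) + 1 / 2 * (∫ x, V ‖x‖ * f (u x) ^ 2)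
    - ∫ x, K ‖x‖ * primG g (f (u x))

/-- `u ∈ E` is a critical point of `I : E → ℝ`: the Fréchet derivative of `I` at `u` with respect
to the norm of `E` is zero. -/
def IsCriticalPoint (V K g : ℝ → ℝ) (u : EuclideanSpace ℝ (Fin N) → ℝ) : Prop :=
  MemE V u ∧ ∀ ε : ℝ, 0 < ε → ∃ δ : ℝ, 0 < δ ∧
    ∀ h : EuclideanSpace ℝ (Fin N) → ℝ, MemE V h → normE V h < δ →
      |energy V K g (fun x => u x + h x) - energy V K g u| ≤ ε * normE V h

/-- `w` is a classical solution of `-Δw + V(|x|) w - w Δ(w²) = K(|x|) g(w)` on `ℝ^N ∖ {0}`: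
it is of class `C²` there and satisfies the equation pointwise. -/
def IsClassicalSolution (V K g : ℝ → ℝ) (w : EuclideanSpace ℝ (Fin N) → ℝ) : Prop :=
  ContDiffOn ℝ 2 w {0}ᶜ ∧
  ∀ x : EuclideanSpace ℝ (Fin N), x ≠ 0 →
    -(Δ w x) + V ‖x‖ * w x - w x * Δ (fun y => w y ^ 2) x = K ‖x‖ * g (w x)

end QuasilinearDual

end

noncomputable section

namespace QuasilinearDual

section

/-! ### The change of variable -/

/-! The substitution `w = f(u)` makes the quasilinear equation semilinear: formally, critical points
of the energy solve `Δu = B`, where `B = (V f(u) - K g(f(u))) f'(u)`. The proof reduces this to an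
ordinary differential equation on `(0, ∞)`, where regularity is elementary.

By the radial lemma (`exists_sq_le_integral_norm_gradient_sq`), `u` agrees a.e. with `U(|x|)` for
some `U` continuous on `(0, ∞)` (`MemD.exists_continuousOn_profile`). The energy is then varied only
in directions `η(|x|)` with `η` smooth and compactly supported in `(0, ∞)`. Along such a line the
Dirichlet part is a quadratic polynomial, and the other two terms can be differentiated under the
integral because `U` and `η` are bounded on the support of `η`. Polar coordinates turn the vanishing
derivative into the weak form of `(r^(N-1) U')' = r^(N-1) B(r)` (`IsCriticalPoint.weak_ode`). No
nonradial test function is needed, and positive homogeneity and nonnegativity are the only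
properties of the norm of `E` used to extract this derivative.

Since `B` is continuous as soon as `U` is, a du Bois-Reymond argument gives `U` two continuous
derivatives (`exists_hasDerivAt_of_weak_ode`), and the chain rule carries the equation over to
`f(U(|x|))` (`isClassicalSolution_of_radial_ode`).

Lean integrals of nonintegrable functions are zero, so differentiating the energy requires its terms
to be integrable. For the nonlinear term this comes from the growth of `g` and `CondS'`
(`integrable_primG`). -/

theorem hasDerivAt_f (t : ℝ) : HasDerivAt f (1 / √(1 + 2 * f t ^ 2)) t := f_solvesCauchy.1 t

theorem f_zero : f 0 = 0 := f_solvesCauchy.2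

theorem continuous_f : Continuous f :=
  continuous_iff_continuousAt.2 fun t => (hasDerivAt_f t).continuousAt

theorem deriv_f : deriv f = fun t => 1 / √(1 + 2 * f t ^ 2) :=
  funext fun t => (hasDerivAt_f t).deriv

theorem continuous_deriv_f : Continuous (deriv f) := by
  rw [deriv_f]
  exact continuous_const.div (by have := continuous_f; fun_prop) fun t => (sqrt_pos' _).ne'

theorem hasDerivAt_deriv_f (t : ℝ) :
    HasDerivAt (deriv f) (-(2 * f t) / (1 + 2 * f t ^ 2) ^ 2) t := by
  rw [deriv_f]
  have h1 : HasDerivAt (fun t => 1 + 2 * f t ^ 2)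
      (2 * (2 * f t * (1 / √(1 + 2 * f t ^ 2)))) t := by
    have := (((hasDerivAt_f t).pow 2).const_mul 2).const_add 1
    simpa using this
  have hp : 0 < 1 + 2 * f t ^ 2 := by positivity
  have h2 := (h1.sqrt hp.ne').inv (sqrt_pos' _).ne'
  simp only [one_div]
  refine h2.congr_deriv ?_
  have hs : √(1 + 2 * f t ^ 2) ≠ 0 := (sqrt_pos' _).ne'
  have hq : √(1 + 2 * f t ^ 2) ^ 2 = 1 + 2 * f t ^ 2 := Real.sq_sqrt hp.le
  have hq4 : (1 + 2 * f t ^ 2) ^ 2 = √(1 + 2 * f t ^ 2) ^ 4 := by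
    calc _ = (√(1 + 2 * f t ^ 2) ^ 2) ^ 2 := by rw [hq]
      _ = _ := by ring
  rw [hq4]
  field_simp

/-- Since `primitive` is explicit and strictly increasing, this lets oddness, monotonicity and
growth of `f` be read off from `primitive`. -/
theorem primitive_f (t : ℝ) : primitive (f t) = t := by
  have hd : ∀ t, HasDerivAt (fun t => primitive (f t) - t) 0 t := by
    intro t
    have h := ((hasDerivAt_primitive (f t)).comp t (hasDerivAt_f t)).sub (hasDerivAt_id t)
    rwa [mul_one_div, div_self (sqrt_pos' _).ne', sub_self] at h
  have hc := is_const_of_deriv_eq_zero (fun t => (hd t).differentiableAt)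
    (fun t => (hd t).deriv) t 0
  simp only [f_zero, primitive_zero, sub_zero] at hc
  linarith

theorem primitive_neg (s : ℝ) : primitive (-s) = -primitive s := by
  have h := intervalIntegral.integral_comp_neg (a := 0) (b := s) fun τ : ℝ => √(1 + 2 * τ ^ 2)
  simp only [neg_sq, neg_zero] at h
  rw [primitive, primitive, intervalIntegral.integral_symm, ← h]

theorem f_neg (t : ℝ) : f (-t) = -f t := by
  apply primitive_strictMono.injective
  rw [primitive_neg, primitive_f, primitive_f]

theorem f_nonneg {t : ℝ} (ht : 0 ≤ t) : 0 ≤ f t := by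
  rw [← primitive_strictMono.le_iff_le, primitive_f, primitive_zero]; exact ht

theorem monotone_f : Monotone f := fun a b h => by
  rw [← primitive_strictMono.le_iff_le, primitive_f, primitive_f]; exact h

theorem f_abs (t : ℝ) : f |t| = |f t| := by
  rcases le_total 0 t with h | h
  · rw [abs_of_nonneg h, abs_of_nonneg (f_nonneg h)]
  · have := f_nonneg (neg_nonneg.2 h)
    rw [abs_of_nonpos h, f_neg, abs_of_nonpos]
    rw [f_neg] at this; linarith

theorem abs_f_le (t : ℝ) : |f t| ≤ |t| := by
  rw [← f_abs]
  have h := primitive_sub_monotone (f_nonneg (abs_nonneg t))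
  simp only [primitive_f, primitive_zero] at h
  linarith

/-- The derivative in `s` of the difference is `c (√(1 + 2c²s²) - √(1 + 2s²))`, nonnegative for `c ≥
1`. Inverted, this bounds `f(ct)` by `c f(t)` for `c ≥ 1` and `t ≥ 0`, which is what makes `E`
stable under scaling. -/
theorem mul_primitive_le {c s : ℝ} (hc : 1 ≤ c) (hs : 0 ≤ s) :
    c * primitive s ≤ primitive (c * s) := by
  have hm : MonotoneOn (fun s => primitive (c * s) - c * primitive s) (Ici 0) := by
    have hd (s : ℝ) : HasDerivAt (fun s => primitive (c * s) - c * primitive s)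
        (√(1 + 2 * (c * s) ^ 2) * c - c * √(1 + 2 * s ^ 2)) s := by
      have h1 : HasDerivAt (fun s : ℝ => c * s) c s := by
        simpa using (hasDerivAt_id s).const_mul c
      exact ((hasDerivAt_primitive (c * s)).comp s h1).sub ((hasDerivAt_primitive s).const_mul c)
    refine monotoneOn_of_deriv_nonneg (convex_Ici 0)
      (fun s _ => (hd s).continuousAt.continuousWithinAt)
      (fun s _ => (hd s).differentiableAt.differentiableWithinAt) fun s _ => ?_
    rw [(hd s).deriv]
    have : √(1 + 2 * s ^ 2) ≤ √(1 + 2 * (c * s) ^ 2) := by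
      apply Real.sqrt_le_sqrt
      nlinarith [mul_nonneg (sub_nonneg.2 (one_le_pow₀ (n := 2) hc)) (sq_nonneg s)]
    nlinarith
  have := hm self_mem_Ici (mem_Ici.2 hs) hs
  simp only [mul_zero, primitive_zero, sub_zero] at this
  linarith

theorem abs_f_mul_le {c : ℝ} (hc : 0 < c) (t : ℝ) : |f (c * t)| ≤ max 1 c * |f t| := by
  rw [← f_abs, ← f_abs, abs_mul, abs_of_pos hc]
  rcases le_total c 1 with h | h
  · rw [max_eq_left h, one_mul]
    exact monotone_f (by nlinarith [abs_nonneg t])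
  · rw [max_eq_right h, ← primitive_strictMono.le_iff_le, primitive_f]
    have := mul_primitive_le h (f_nonneg (abs_nonneg t))
    rwa [primitive_f] at this

/-! ### Test functions on the half line -/

/-- Smooth functions on `ℝ` with compact support in `(0, ∞)`. -/
def RayTest (A : ℝ → ℝ) : Prop :=
  ContDiff ℝ (⊤ : ℕ∞) A ∧ ∃ a b, 0 < a ∧ a < b ∧ ∀ t, t ≤ a ∨ b ≤ t → A t = 0

namespace RayTest

variable {A : ℝ → ℝ}

/-- Vanishing near every `t ≤ 0` allows products with functions controlled only on `(0, ∞)`, such as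
`V` or negative powers of `r`, to be treated as regular functions on all of `ℝ`. -/
theorem eventually_zero (hA : RayTest A) : ∀ t ≤ 0, ∀ᶠ s in 𝓝 t, A s = 0 := by
  obtain ⟨-, a, b, ha, -, h⟩ := hA
  intro t ht
  filter_upwards [Iio_mem_nhds (lt_of_le_of_lt ht ha)] with s hs
  exact h s (Or.inl (le_of_lt hs))

theorem zero_of_nonpos (hA : RayTest A) {t : ℝ} (ht : t ≤ 0) : A t = 0 :=
  (hA.eventually_zero t ht).self_of_nhds

theorem smul_contDiffAt (hA : RayTest A) {q : ℝ → ℝ}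
    (hq : ∀ t, 0 < t → ContDiffAt ℝ (⊤ : ℕ∞) q t) : RayTest fun t => q t * A t := by
  refine ⟨contDiff_iff_contDiffAt.2 fun t => ?_, ?_⟩
  · rcases lt_or_ge 0 t with ht | ht
    · exact (hq t ht).mul hA.1.contDiffAt
    · refine (contDiffAt_const (c := (0 : ℝ))).congr_of_eventuallyEq ?_
      filter_upwards [hA.eventually_zero t ht] with s hs
      simp [hs]
  · obtain ⟨-, a, b, ha, hab, h⟩ := hA
    exact ⟨a, b, ha, hab, fun t ht => by simp [h t ht]⟩

theorem hasCompactSupport (hA : RayTest A) : HasCompactSupport A := by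
  obtain ⟨-, a, b, ha, -, h⟩ := hA
  refine HasCompactSupport.intro (isCompact_Icc (a := a) (b := b)) fun t ht => h t ?_
  rw [mem_Icc, not_and_or, not_le, not_le] at ht
  exact ht.imp le_of_lt le_of_lt

theorem deriv (hA : RayTest A) : RayTest (deriv A) := by
  refine ⟨?_, ?_⟩
  · have : ContDiff ℝ ((⊤ : ℕ∞) + 1 : WithTop ℕ∞) A := by simpa using hA.1
    exact (contDiff_succ_iff_deriv.1 this).2.2
  · obtain ⟨-, a, b, ha, hab, h⟩ := hA
    refine ⟨a / 2, b + 1, by linarith, by linarith, fun t ht => ?_⟩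
    have : A =ᶠ[𝓝 t] fun _ => 0 := by
      rcases ht with ht | ht
      · filter_upwards [Iio_mem_nhds (show t < a by linarith)] with s hs
        exact h s (Or.inl (le_of_lt hs))
      · filter_upwards [Ioi_mem_nhds (show b < t by linarith)] with s hs
        exact h s (Or.inr (le_of_lt hs))
    rw [this.deriv_eq, deriv_const]

theorem differentiable (hA : RayTest A) : Differentiable ℝ A := hA.1.differentiable (by simp)

theorem sub (hA : RayTest A) {B : ℝ → ℝ} (hB : RayTest B) : RayTest fun t => A t - B t := by
  obtain ⟨hA, a, b, ha, hab, h⟩ := hA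
  obtain ⟨hB, a', b', ha', hab', h'⟩ := hB
  refine ⟨hA.sub hB, min a a', max b b', lt_min ha ha',
    (min_le_left _ _).trans_lt (hab.trans_le (le_max_left _ _)), fun t ht => ?_⟩
  beta_reduce
  rw [h t (ht.imp (fun h => h.trans (min_le_left _ _)) fun h => (le_max_left _ _).trans h),
    h' t (ht.imp (fun h => h.trans (min_le_right _ _)) fun h => (le_max_right _ _).trans h),
    sub_zero]

theorem const_mul (hA : RayTest A) (c : ℝ) : RayTest fun t => c * A t :=
  hA.smul_contDiffAt fun _ _ => contDiffAt_const

theorem continuous_mul (hA : RayTest A) {W : ℝ → ℝ} (hW : ContinuousOn W (Ioi 0)) :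
    Continuous fun t => W t * A t := by
  refine continuous_iff_continuousAt.2 fun t => ?_
  rcases lt_or_ge 0 t with ht | ht
  · exact (hW.continuousAt (Ioi_mem_nhds ht)).mul hA.1.continuous.continuousAt
  · refine (continuousAt_const (y := (0 : ℝ))).congr ?_
    filter_upwards [hA.eventually_zero t ht] with s hs
    simp [hs]

theorem integrable_mul (hA : RayTest A) {W : ℝ → ℝ} (hW : ContinuousOn W (Ioi 0)) :
    Integrable fun t => W t * A t :=
  (hA.continuous_mul hW).integrable_of_hasCompactSupport hA.hasCompactSupport.mul_left

theorem integral_by_parts (hA : RayTest A) {W W' : ℝ → ℝ}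
    (hW : ∀ t, 0 < t → HasDerivAt W (W' t) t) (hW' : ContinuousOn W' (Ioi 0)) :
    ∫ t, W t * _root_.deriv A t = -∫ t, W' t * A t := by
  have hWc : ContinuousOn W (Ioi 0) := fun t ht => (hW t ht).continuousAt.continuousWithinAt
  have hd (t : ℝ) : HasDerivAt (fun t => W t * A t) (W' t * A t + W t * _root_.deriv A t) t := by
    rcases lt_or_ge 0 t with ht | ht
    · exact (hW t ht).mul (hA.differentiable t).hasDerivAt
    · rw [hA.zero_of_nonpos ht, hA.deriv.zero_of_nonpos ht, mul_zero, mul_zero, add_zero]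
      refine (hasDerivAt_const t (0 : ℝ)).congr_of_eventuallyEq ?_
      filter_upwards [hA.eventually_zero t ht] with s hs
      simp [hs]
  have h := integral_eq_zero_of_hasDerivAt_of_integrable hd
    ((hA.integrable_mul hW').add (hA.deriv.integrable_mul hWc)) (hA.integrable_mul hWc)
  rw [integral_add (hA.integrable_mul hW') (hA.deriv.integrable_mul hWc)] at h
  linarith

/-- The primitive based at the left end of the support vanishes to the left; past the right end it
equals the total integral, which is zero. -/
theorem exists_primitive (hA : RayTest A) (h0 : ∫ t, A t = 0) :
    ∃ η, RayTest η ∧ _root_.deriv η = A := by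
  obtain ⟨hs, a, b, ha, hab, h⟩ := hA
  have hd (t : ℝ) : HasDerivAt (fun t => ∫ s in a..t, A s) (A t) t :=
    intervalIntegral.integral_hasDerivAt_right (hs.continuous.intervalIntegrable _ _)
      (hs.continuous.stronglyMeasurableAtFilter _ _) hs.continuous.continuousAt
  have hde : _root_.deriv (fun t => ∫ s in a..t, A s) = A := funext fun t => (hd t).deriv
  refine ⟨fun t => ∫ s in a..t, A s, ⟨?_, a, b, ha, hab, ?_⟩, hde⟩
  · have : ContDiff ℝ ((⊤ : ℕ∞) + 1 : WithTop ℕ∞) (fun t => ∫ s in a..t, A s) := by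
      rw [contDiff_succ_iff_deriv, hde]
      exact ⟨fun t => (hd t).differentiableAt, by simp, hs⟩
    simpa using this
  · rintro t (ht | ht)
    · beta_reduce
      rw [intervalIntegral.integral_symm, intervalIntegral.integral_zero_ae, neg_zero]
      refine Eventually.of_forall fun s hs => h s (Or.inl ?_)
      rw [uIoc_of_le ht] at hs
      exact hs.2
    · beta_reduce
      rw [intervalIntegral.integral_eq_integral_of_support_subset, h0]
      intro s hs
      by_contra hn
      rw [mem_Ioc, not_and_or, not_lt, not_le] at hn
      exact hs (h s (hn.imp id fun h => ht.trans h.le))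

end RayTest

theorem rayTest_of_tsupport_subset {A : ℝ → ℝ} (hA : ContDiff ℝ (⊤ : ℕ∞) A)
    (hc : HasCompactSupport A) (hs : tsupport A ⊆ Ioi 0) : RayTest A := by
  refine ⟨hA, ?_⟩
  rcases (tsupport A).eq_empty_or_nonempty with he | hne
  · exact ⟨1, 2, one_pos, one_lt_two, fun t _ => by
      rw [tsupport_eq_empty_iff.1 he]; rfl⟩
  · obtain ⟨a, ha, hmin⟩ := hc.isCompact.exists_isLeast hne
    obtain ⟨b, hb, hmax⟩ := hc.isCompact.exists_isGreatest hne
    have ha0 : 0 < a := hs ha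
    have hab : a ≤ b := hmin hb
    refine ⟨a / 2, b + 1, by linarith, by linarith, fun t ht => ?_⟩
    by_contra hne
    have hm := subset_tsupport A (Function.mem_support.2 hne)
    rcases ht with ht | ht
    · have := hmin hm; linarith
    · have := hmax hm; linarith

/-! ### The du Bois-Reymond lemma and regularity for the weak radial equation -/

theorem exists_rayTest_integral_eq_one : ∃ ρ, RayTest ρ ∧ ∫ t, ρ t = 1 := by
  let φ : ContDiffBump (1 : ℝ) := ⟨1 / 4, 1 / 2, by norm_num, by norm_num⟩
  refine ⟨φ.normed volume, rayTest_of_tsupport_subset φ.contDiff_normed φ.hasCompactSupport_normed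
    ?_, φ.integral_normed⟩
  rw [φ.tsupport_normed_eq]
  intro t ht
  rw [Metric.mem_closedBall, Real.dist_eq] at ht
  have := (abs_le.1 ht).1
  have h2 : φ.rOut = 1 / 2 := rfl
  rw [h2] at this
  rw [mem_Ioi]; linarith

/-- The lemma of du Bois-Reymond on the half line. -/
theorem exists_const_of_integral_mul_deriv_eq_zero {W : ℝ → ℝ} (hW : ContinuousOn W (Ioi 0))
    (h : ∀ A, RayTest A → ∫ t, W t * deriv A t = 0) : ∃ c, ∀ t, 0 < t → W t = c := by
  obtain ⟨ρ, hρ, hρ1⟩ := exists_rayTest_integral_eq_one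
  refine ⟨∫ t, W t * ρ t, ?_⟩
  set c := ∫ t, W t * ρ t with hc
  have hWc : ContinuousOn (fun t => W t - c) (Ioi 0) := hW.sub continuousOn_const
  have key (ζ : ℝ → ℝ) (hζ : RayTest ζ) : ∫ t, (W t - c) * ζ t = 0 := by
    have hi : Integrable ζ := by simpa using hζ.integrable_mul (continuousOn_const (c := (1 : ℝ)))
    have hiρ : Integrable ρ := by simpa using hρ.integrable_mul (continuousOn_const (c := (1 : ℝ)))
    -- Subtracting a multiple of the unit-mass bump makes the mean zero, so the result is the
    -- derivative of an admissible test function.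
    have hz := hζ.sub (hρ.const_mul (∫ t, ζ t))
    obtain ⟨η, hη, hde⟩ := hz.exists_primitive (by
      rw [integral_sub hi (hiρ.const_mul _), integral_const_mul, hρ1, mul_one, sub_self])
    have h1 := h η hη
    have e1 : ∀ t, W t * deriv η t = W t * ζ t - (∫ t, ζ t) * (W t * ρ t) := fun t => by
      rw [hde]; ring
    simp only [e1] at h1
    rw [integral_sub (hζ.integrable_mul hW) ((hρ.integrable_mul hW).const_mul _),
      integral_const_mul, ← hc] at h1
    have e2 : ∀ t, (W t - c) * ζ t = W t * ζ t - c * ζ t := fun t => by ring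
    simp only [e2]
    rw [integral_sub (hζ.integrable_mul hW) (hi.const_mul _), integral_const_mul]
    linarith
  have hae := isOpen_Ioi.ae_eq_zero_of_integral_contDiff_smul_eq_zero
    (hWc.locallyIntegrableOn measurableSet_Ioi (μ := volume)) fun A hA hAc hAs => by
      have := key A (rayTest_of_tsupport_subset hA hAc hAs)
      simpa [mul_comm] using this
  have heq : (fun t => W t - c) =ᵐ[volume.restrict (Ioi 0)] fun _ => 0 :=
    (ae_restrict_iff' measurableSet_Ioi).2 hae
  have := Measure.eqOn_open_of_ae_eq heq isOpen_Ioi hWc continuousOn_const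
  intro t ht
  have := this ht
  simp only at this
  linarith

theorem hasDerivAt_integral_of_continuousOn_Ioi {D : ℝ → ℝ} (hD : ContinuousOn D (Ioi 0)) {t : ℝ}
    (ht : 0 < t) : HasDerivAt (fun t => ∫ s in (1 : ℝ)..t, D s) (D t) t := by
  have hsub : uIcc 1 t ⊆ Ioi 0 := fun s hs => lt_of_lt_of_le (lt_min one_pos ht) hs.1
  refine intervalIntegral.integral_hasDerivAt_right (hD.mono hsub).intervalIntegrable
    ?_ (hD.continuousAt (Ioi_mem_nhds ht))
  exact hD.stronglyMeasurableAtFilter isOpen_Ioi t ht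

/-- A continuous weak solution of `(r ^ m U')' = r ^ m B` on the half line, with `B` continuous,
is a classical one. -/
theorem exists_hasDerivAt_of_weak_ode (m : ℕ) {U B : ℝ → ℝ} (hU : ContinuousOn U (Ioi 0))
    (hB : ContinuousOn B (Ioi 0))
    (h : ∀ η, RayTest η → ∫ r, U r * deriv (fun r => r ^ m * deriv η r) r =
      ∫ r, r ^ m * B r * η r) :
    ∃ P : ℝ → ℝ, ∀ r, 0 < r → HasDerivAt U (P r) r ∧ HasDerivAt P (B r - m / r * P r) r := by
  have hp : ContinuousOn (fun r : ℝ => r ^ m) (Ioi 0) := by fun_prop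
  have hpi : ContinuousOn (fun r : ℝ => (r ^ m)⁻¹) (Ioi 0) :=
    hp.inv₀ fun r hr => (pow_pos hr m).ne'
  have hps (r : ℝ) (hr : 0 < r) : ContDiffAt ℝ (⊤ : ℕ∞) (fun r : ℝ => (r ^ m)⁻¹) r :=
    (contDiff_id.pow m).contDiffAt.inv (pow_pos hr m).ne'
  -- `Z` is a particular solution, with `r^m Z' = D` and `D' = r^m B`; `Q` solves the homogeneous
  -- equation, with `r^m Q' = 1`. The goal is that `U - Z` is a constant plus a multiple of `Q`.
  set D := fun r => ∫ s in (1 : ℝ)..r, s ^ m * B s with hDdef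
  have hD (r : ℝ) (hr : 0 < r) : HasDerivAt D (r ^ m * B r) r :=
    hasDerivAt_integral_of_continuousOn_Ioi (hp.mul hB) hr
  have hDc : ContinuousOn D (Ioi 0) := fun r hr => (hD r hr).continuousAt.continuousWithinAt
  set Z := fun r => ∫ s in (1 : ℝ)..r, (s ^ m)⁻¹ * D s with hZdef
  have hZ (r : ℝ) (hr : 0 < r) : HasDerivAt Z ((r ^ m)⁻¹ * D r) r :=
    hasDerivAt_integral_of_continuousOn_Ioi (hpi.mul hDc) hr
  have hZc : ContinuousOn Z (Ioi 0) := fun r hr => (hZ r hr).continuousAt.continuousWithinAt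
  set Q := fun r => ∫ s in (1 : ℝ)..r, (s ^ m)⁻¹ with hQdef
  have hQ (r : ℝ) (hr : 0 < r) : HasDerivAt Q (r ^ m)⁻¹ r :=
    hasDerivAt_integral_of_continuousOn_Ioi hpi hr
  have hQc : ContinuousOn Q (Ioi 0) := fun r hr => (hQ r hr).continuousAt.continuousWithinAt
  have hUZ : ContinuousOn (fun r => U r - Z r) (Ioi 0) := hU.sub hZc
  -- The functions `A = r^m η'` reachable from test functions are exactly those orthogonal to
  -- `r^(-m)`, so the hypothesis gives information only on this hyperplane.
  have step (A : ℝ → ℝ) (hA : RayTest A) (hA0 : ∫ r, (r ^ m)⁻¹ * A r = 0) :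
      ∫ r, (U r - Z r) * deriv A r = 0 := by
    obtain ⟨η, hη, hde⟩ := (hA.smul_contDiffAt hps).exists_primitive hA0
    have h1 := h η hη
    have hA' : (fun r => r ^ m * deriv η r) = A := by
      funext r
      rw [hde]
      beta_reduce
      rcases lt_or_ge 0 r with hr | hr
      · rw [mul_inv_cancel_left₀ (pow_pos hr m).ne']
      · rw [hA.zero_of_nonpos hr, mul_zero, mul_zero]
    have h2 := hη.integral_by_parts hD (hp.mul hB)
    have h3 := hA.integral_by_parts hZ (hpi.mul hDc)
    rw [hA'] at h1
    have e : ∀ r, D r * deriv η r = (r ^ m)⁻¹ * D r * A r := fun r => by rw [hde]; ring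
    simp only [e] at h2
    simp only [sub_mul]
    rw [integral_sub (hA.deriv.integrable_mul hU) (hA.deriv.integrable_mul hZc), h1, h3, h2]
    ring
  obtain ⟨ρ, hρ, hρ1⟩ := exists_rayTest_integral_eq_one
  have hρ2 := hρ.smul_contDiffAt (q := fun r => r ^ m) fun r _ => (contDiff_id.pow m).contDiffAt
  have hρ3 : ∫ r, (r ^ m)⁻¹ * (r ^ m * ρ r) = 1 := by
    rw [← hρ1]
    congr 1
    funext r
    rcases lt_or_ge 0 r with hr | hr
    · rw [inv_mul_cancel_left₀ (pow_pos hr m).ne']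
    · rw [hρ.zero_of_nonpos hr, mul_zero, mul_zero]
  set A₀ := fun r => r ^ m * ρ r with hA₀
  set c := ∫ r, (U r - Z r) * deriv A₀ r with hc
  -- A general `A` is projected onto that hyperplane along `A₀`, normalised by `∫ r^(-m) A₀ = 1`.
  -- The error is `c ∫ r^(-m) A = -c ∫ Q A'`, which is absorbed by adding `c Q`.
  obtain ⟨k, hk⟩ := exists_const_of_integral_mul_deriv_eq_zero
    (W := fun r => (U r - Z r) + c * Q r) (hUZ.add (hQc.const_mul c)) fun A hA => by
      have h1 := step _ (hA.sub (hρ2.const_mul (∫ r, (r ^ m)⁻¹ * A r))) (by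
        simp only [mul_sub, mul_left_comm _ (∫ r, (r ^ m)⁻¹ * A r)]
        rw [integral_sub (hA.integrable_mul hpi) ((hρ2.integrable_mul hpi).const_mul _),
          integral_const_mul, hρ3, mul_one, sub_self])
      have hde : ∀ r, deriv (fun t => A t - (∫ r, (r ^ m)⁻¹ * A r) * A₀ t) r =
          deriv A r - (∫ r, (r ^ m)⁻¹ * A r) * deriv A₀ r := fun r =>
        ((hA.differentiable r).hasDerivAt.sub
          ((hρ2.differentiable r).hasDerivAt.const_mul _)).deriv
      simp only [hde, mul_sub, mul_left_comm _ (∫ r, (r ^ m)⁻¹ * A r)] at h1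
      rw [integral_sub (hA.deriv.integrable_mul hUZ)
        ((hρ2.deriv.integrable_mul hUZ).const_mul _), integral_const_mul, ← hc] at h1
      have h3 := hA.integral_by_parts hQ hpi
      simp only [add_mul, mul_assoc c]
      rw [integral_add (hA.deriv.integrable_mul hUZ) ((hA.deriv.integrable_mul hQc).const_mul _),
        integral_const_mul, h3]
      linarith
  refine ⟨fun r => (r ^ m)⁻¹ * (D r - c), fun r hr => ⟨?_, ?_⟩⟩
  · have h1 : HasDerivAt (fun r => k + Z r - c * Q r)
        ((r ^ m)⁻¹ * D r - c * (r ^ m)⁻¹) r :=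
      ((hZ r hr).const_add k).sub ((hQ r hr).const_mul c)
    refine (h1.congr_of_eventuallyEq ?_).congr_deriv (by ring)
    filter_upwards [Ioi_mem_nhds hr] with s hs
    have := hk s hs
    linarith
  · have h1 := ((hasDerivAt_pow m r).inv (pow_pos hr m).ne').mul ((hD r hr).sub_const c)
    refine h1.congr_deriv ?_
    -- The derivative of `r ^ m` involves the truncated exponent `m - 1`, so `m = 0` is separate.
    rcases m with _ | m
    · simp
    · have : r ^ (m + 1) ≠ 0 := (pow_pos hr _).ne'
      simp only [Pi.inv_apply, add_tsub_cancel_right]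
      field_simp
      ring

end

section

variable {N : ℕ}

/-! ### Calculus of radial functions -/

theorem hasFDerivAt_norm_of_ne_zero {x : EuclideanSpace ℝ (Fin N)} (hx : x ≠ 0) :
    HasFDerivAt (fun y : EuclideanSpace ℝ (Fin N) => ‖y‖) (‖x‖⁻¹ • innerSL ℝ x) x := by
  have h := (hasStrictFDerivAt_norm_sq x).hasFDerivAt.sqrt (by simpa using hx)
  simp only [Real.sqrt_sq (norm_nonneg _)] at h
  refine h.congr_fderiv ?_
  ext v
  have : ‖x‖ ≠ 0 := norm_ne_zero_iff.2 hx
  simp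
  field_simp

theorem hasFDerivAt_comp_norm {Φ : ℝ → ℝ} {d : ℝ} {x : EuclideanSpace ℝ (Fin N)} (hx : x ≠ 0)
    (h : HasDerivAt Φ d ‖x‖) :
    HasFDerivAt (fun y : EuclideanSpace ℝ (Fin N) => Φ ‖y‖) ((d / ‖x‖) • innerSL ℝ x) x := by
  refine (h.comp_hasFDerivAt x (hasFDerivAt_norm_of_ne_zero hx)).congr_fderiv ?_
  rw [smul_smul, div_eq_mul_inv]

theorem hasGradientAt_comp_norm {Φ : ℝ → ℝ} {d : ℝ} {x : EuclideanSpace ℝ (Fin N)} (hx : x ≠ 0)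
    (h : HasDerivAt Φ d ‖x‖) :
    HasGradientAt (fun y : EuclideanSpace ℝ (Fin N) => Φ ‖y‖) ((d / ‖x‖) • x) x := by
  rw [hasGradientAt_iff_hasFDerivAt]
  refine (hasFDerivAt_comp_norm hx h).congr_fderiv ?_
  ext v
  simp

theorem norm_gradient_comp_norm {Φ : ℝ → ℝ} {d : ℝ} {x : EuclideanSpace ℝ (Fin N)} (hx : x ≠ 0)
    (h : HasDerivAt Φ d ‖x‖) :
    ‖gradient (fun y : EuclideanSpace ℝ (Fin N) => Φ ‖y‖) x‖ = |d| := by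
  rw [(hasGradientAt_comp_norm hx h).gradient, norm_smul, norm_div, norm_norm,
    div_mul_cancel₀ _ (norm_ne_zero_iff.2 hx), Real.norm_eq_abs]

theorem laplacian_comp_norm {Φ Φ₁ : ℝ → ℝ} {d : ℝ} {x : EuclideanSpace ℝ (Fin N)} (hx : x ≠ 0)
    (h : ∀ r, 0 < r → HasDerivAt Φ (Φ₁ r) r) (h₁ : HasDerivAt Φ₁ d ‖x‖) :
    (Δ (fun y : EuclideanSpace ℝ (Fin N) => Φ ‖y‖)) x = d + (N - 1) / ‖x‖ * Φ₁ ‖x‖ := by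
  have hn : 0 < ‖x‖ := norm_pos_iff.2 hx
  have e1 : fderiv ℝ (fun y : EuclideanSpace ℝ (Fin N) => Φ ‖y‖) =ᶠ[𝓝 x]
      fun y => (Φ₁ ‖y‖ / ‖y‖) • innerSL ℝ y := by
    filter_upwards [isOpen_ne.mem_nhds hx] with y hy
    exact (hasFDerivAt_comp_norm hy (h _ (norm_pos_iff.2 hy))).fderiv
  have hk : HasDerivAt (fun r => Φ₁ r / r) ((d * ‖x‖ - Φ₁ ‖x‖ * 1) / ‖x‖ ^ 2) ‖x‖ :=
    h₁.div (hasDerivAt_id _) hn.ne'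
  have e2 := (hasFDerivAt_comp_norm hx hk).smul
    ((innerSL ℝ (E := EuclideanSpace ℝ (Fin N))).hasFDerivAt (x := x))
  have e3 := e1.fderiv_eq.trans e2.fderiv
  rw [InnerProductSpace.laplacian_eq_iteratedFDeriv_orthonormalBasis _
    (EuclideanSpace.basisFun (Fin N) ℝ)]
  -- The Hessian is `(Φ₁/r) Id + ((Φ₁/r)'/r) x ⊗ x`; its trace is the Laplacian.
  have e6 (v : EuclideanSpace ℝ (Fin N)) :
      fderiv ℝ (fderiv ℝ fun y : EuclideanSpace ℝ (Fin N) => Φ ‖y‖) x v v =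
        Φ₁ ‖x‖ / ‖x‖ * inner ℝ v v +
          (d * ‖x‖ - Φ₁ ‖x‖ * 1) / ‖x‖ ^ 2 / ‖x‖ * inner ℝ x v * inner ℝ x v := by
    rw [e3]; rfl
  simp only [iteratedFDeriv_two_apply, Matrix.cons_val_zero, Matrix.cons_val_one, e6]
  have e4 : ‖x‖ ^ 2 = ∑ i, x i ^ 2 := EuclideanSpace.real_norm_sq_eq x
  simp [Finset.sum_add_distrib, EuclideanSpace.inner_single_right]
  have e5 : ∀ i, (d * ‖x‖ - Φ₁ ‖x‖) / ‖x‖ ^ 2 / ‖x‖ * x i * x i =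
      (d * ‖x‖ - Φ₁ ‖x‖) / ‖x‖ ^ 2 / ‖x‖ * x i ^ 2 := fun i => by ring
  simp only [e5, ← Finset.mul_sum, ← e4]
  field_simp
  ring

/-! ### Radial test functions away from the origin -/

theorem contDiffAt_comp_norm {n : WithTop ℕ∞} {Φ : ℝ → ℝ} {x : EuclideanSpace ℝ (Fin N)}
    (hx : x ≠ 0) (h : ContDiffAt ℝ n Φ ‖x‖) :
    ContDiffAt ℝ n (fun y : EuclideanSpace ℝ (Fin N) => Φ ‖y‖) x :=
  h.comp x (contDiffAt_norm ℝ hx)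

theorem RayTest.contDiff_comp_norm {η : ℝ → ℝ} (hη : RayTest η) :
    ContDiff ℝ (⊤ : ℕ∞) (fun x : EuclideanSpace ℝ (Fin N) => η ‖x‖) := by
  refine contDiff_iff_contDiffAt.2 fun x => ?_
  rcases eq_or_ne x 0 with rfl | hx
  · refine (contDiffAt_const (c := (0 : ℝ))).congr_of_eventuallyEq ?_
    have h0 := hη.eventually_zero ‖(0 : EuclideanSpace ℝ (Fin N))‖ (by simp)
    exact continuous_norm.continuousAt.eventually h0
  · exact contDiffAt_comp_norm hx hη.1.contDiffAt

theorem RayTest.hasCompactSupport_comp_norm {η : ℝ → ℝ} (hη : RayTest η) :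
    HasCompactSupport (fun x : EuclideanSpace ℝ (Fin N) => η ‖x‖) := by
  obtain ⟨-, a, b, -, -, h⟩ := hη
  refine HasCompactSupport.intro (isCompact_closedBall (0 : EuclideanSpace ℝ (Fin N)) b)
    fun x hx => h _ (Or.inr ?_)
  rw [mem_closedBall_zero_iff, not_le] at hx
  exact hx.le

theorem RayTest.isRadialTest {η : ℝ → ℝ} (hη : RayTest η) :
    IsRadialTest (fun x : EuclideanSpace ℝ (Fin N) => η ‖x‖) :=
  ⟨hη.contDiff_comp_norm, hη.hasCompactSupport_comp_norm, fun x y h => by simp only [h]⟩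

theorem RayTest.gradient_comp_norm {η : ℝ → ℝ} (hη : RayTest η) (x : EuclideanSpace ℝ (Fin N)) :
    gradient (fun x : EuclideanSpace ℝ (Fin N) => η ‖x‖) x = (_root_.deriv η ‖x‖ / ‖x‖) • x := by
  rcases eq_or_ne x 0 with rfl | hx
  · have h0 := hη.eventually_zero ‖(0 : EuclideanSpace ℝ (Fin N))‖ (by simp)
    have h1 : (fun x : EuclideanSpace ℝ (Fin N) => η ‖x‖) =ᶠ[𝓝 0] fun _ => 0 :=
      continuous_norm.continuousAt.eventually h0
    rw [h1.gradient_eq]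
    simp
  · exact (hasGradientAt_comp_norm hx (hη.differentiable _).hasDerivAt).gradient

/-! ### Polar coordinates -/

/-- The measure of the unit sphere. -/
def sphereConst (N : ℕ) : ℝ := N * volume.real (Metric.ball (0 : EuclideanSpace ℝ (Fin N)) 1)

theorem sphereConst_pos (hN : 0 < N) : 0 < sphereConst N := by
  refine mul_pos (Nat.cast_pos.2 hN) ?_
  exact ENNReal.toReal_pos (Metric.measure_ball_pos _ _ one_pos).ne' measure_ball_lt_top.ne

theorem integral_comp_norm (hN : 0 < N) (F : ℝ → ℝ) :
    ∫ x : EuclideanSpace ℝ (Fin N), F ‖x‖ =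
      sphereConst N * ∫ r in Ioi (0 : ℝ), r ^ (N - 1) * F r := by
  have : Nonempty (Fin N) := ⟨⟨0, hN⟩⟩
  rw [integral_fun_norm_addHaar volume F]
  simp [sphereConst, mul_assoc]

theorem integrable_comp_norm (hN : 0 < N) {F : ℝ → ℝ} :
    Integrable (fun x : EuclideanSpace ℝ (Fin N) => F ‖x‖) ↔
      IntegrableOn (fun r => r ^ (N - 1) * F r) (Ioi 0) := by
  have : Nonempty (Fin N) := ⟨⟨0, hN⟩⟩
  rw [integrable_fun_norm_addHaar volume]
  simp

theorem RayTest.setIntegral_Ioi {A : ℝ → ℝ} (hA : RayTest A) (F : ℝ → ℝ) :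
    ∫ r in Ioi 0, F r * A r = ∫ r, F r * A r :=
  setIntegral_eq_integral_of_forall_compl_eq_zero fun r hr => by
    rw [hA.zero_of_nonpos (not_lt.1 hr), mul_zero]

/-! ### Weak gradients -/

variable {u v : EuclideanSpace ℝ (Fin N) → ℝ}
  {G H : EuclideanSpace ℝ (Fin N) → EuclideanSpace ℝ (Fin N)}

theorem continuous_gradient {φ : EuclideanSpace ℝ (Fin N) → ℝ} (hφ : ContDiff ℝ (⊤ : ℕ∞) φ) :
    Continuous (gradient φ) :=
  (InnerProductSpace.toDual ℝ _).symm.continuous.comp (hφ.continuous_fderiv (by simp))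

theorem hasCompactSupport_gradient {φ : EuclideanSpace ℝ (Fin N) → ℝ}
    (hc : HasCompactSupport φ) : HasCompactSupport (gradient φ) :=
  (hc.fderiv (𝕜 := ℝ)).comp_left (map_zero _)

theorem inner_gradient (φ : EuclideanSpace ℝ (Fin N) → ℝ) (x y : EuclideanSpace ℝ (Fin N)) :
    inner ℝ y (gradient φ x) = fderiv ℝ φ x y := by
  rw [real_inner_comm]
  simp [gradient]

/-- `weakGrad` is obtained by choice, so every computation with it passes through this a.e.
uniqueness. -/
theorem IsWeakGradient.unique (h₁ : IsWeakGradient u G) (h₂ : IsWeakGradient u H) : G =ᵐ[volume] H := by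
  have hl : LocallyIntegrable (fun x => G x - H x) := h₁.2.1.sub h₂.2.1
  have := ae_eq_zero_of_integral_contDiff_smul_eq_zero hl fun φ hφ hc => by
    simp only [smul_sub]
    rw [integral_sub (h₁.2.1.integrable_smul_left_of_hasCompactSupport hφ.continuous hc)
      (h₂.2.1.integrable_smul_left_of_hasCompactSupport hφ.continuous hc), sub_eq_zero]
    have e₁ := h₁.2.2 φ hφ hc
    rw [h₂.2.2 φ hφ hc, neg_inj] at e₁
    exact e₁.symm
  filter_upwards [this] with x hx
  exact sub_eq_zero.1 hx

theorem isWeakGradient_weakGrad (h : ∃ G, IsWeakGradient u G) : IsWeakGradient u (weakGrad u) := by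
  rw [weakGrad, dif_pos h]
  exact h.choose_spec

theorem IsWeakGradient.weakGrad_ae_eq (h : IsWeakGradient u G) : weakGrad u =ᵐ[volume] G :=
  (isWeakGradient_weakGrad ⟨G, h⟩).unique h

theorem IsWeakGradient.add_smul (h₁ : IsWeakGradient u G) (h₂ : IsWeakGradient v H) (a b : ℝ) :
    IsWeakGradient (fun x => a * u x + b * v x) (fun x => a • G x + b • H x) := by
  refine ⟨(h₁.1.smul a).add (h₂.1.smul b), (h₁.2.1.smul a).add (h₂.2.1.smul b),
    fun φ hφ hc => ?_⟩
  have i₁ := h₁.1.integrable_smul_right_of_hasCompactSupport (continuous_gradient hφ)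
    (hasCompactSupport_gradient hc)
  have i₂ := h₂.1.integrable_smul_right_of_hasCompactSupport (continuous_gradient hφ)
    (hasCompactSupport_gradient hc)
  have j₁ := h₁.2.1.integrable_smul_left_of_hasCompactSupport hφ.continuous hc
  have j₂ := h₂.2.1.integrable_smul_left_of_hasCompactSupport hφ.continuous hc
  have e (x) : (a * u x + b * v x) • gradient φ x =
      a • u x • gradient φ x + b • v x • gradient φ x := by module
  have e' (x) : φ x • (a • G x + b • H x) = a • φ x • G x + b • φ x • H x := by module
  simp only [e, e']
  have s₁ := integral_add (i₁.smul a) (i₂.smul b)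
  have s₂ := integral_add (j₁.smul a) (j₂.smul b)
  simp only [Pi.smul_apply] at s₁ s₂
  rw [s₁, s₂, integral_smul, integral_smul, integral_smul, integral_smul, h₁.2.2 φ hφ hc,
    h₂.2.2 φ hφ hc]
  module

theorem IsWeakGradient.integral_mul_fderiv (h : IsWeakGradient u G)
    {φ : EuclideanSpace ℝ (Fin N) → ℝ} (hφ : ContDiff ℝ (⊤ : ℕ∞) φ) (hc : HasCompactSupport φ)
    (e : EuclideanSpace ℝ (Fin N)) :
    ∫ x, u x * fderiv ℝ φ x e = -∫ x, φ x * inner ℝ e (G x) := by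
  have i := h.1.integrable_smul_right_of_hasCompactSupport (continuous_gradient hφ)
    (hasCompactSupport_gradient hc)
  have j := h.2.1.integrable_smul_left_of_hasCompactSupport hφ.continuous hc
  have := congrArg (fun z => inner ℝ e z) (h.2.2 φ hφ hc)
  rw [inner_neg_right] at this
  rw [← integral_inner i, ← integral_inner j] at this
  simpa only [inner_smul_right, inner_gradient] using this

theorem isWeakGradient_gradient {φ : EuclideanSpace ℝ (Fin N) → ℝ} (hφ : ContDiff ℝ (⊤ : ℕ∞) φ)
    (hc : HasCompactSupport φ) : IsWeakGradient φ (gradient φ) := by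
  have hg := continuous_gradient hφ
  have hgc := hasCompactSupport_gradient hc
  refine ⟨hφ.continuous.locallyIntegrable, hg.locallyIntegrable, fun ψ hψ hcψ => ?_⟩
  have i : Integrable fun x => φ x • gradient ψ x :=
    (hφ.continuous.smul (continuous_gradient hψ)).integrable_of_hasCompactSupport hc.smul_right
  have j : Integrable fun x => ψ x • gradient φ x :=
    (hψ.continuous.smul hg).integrable_of_hasCompactSupport hcψ.smul_right
  refine ext_inner_left ℝ fun e => ?_
  rw [inner_neg_right, ← integral_inner i, ← integral_inner j]
  simp only [inner_smul_right, inner_gradient]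
  have hφ' := hφ.continuous_fderiv (by simp)
  have hψ' := hψ.continuous_fderiv (by simp)
  have := integral_mul_fderiv_eq_neg_fderiv_mul_of_integrable (μ := volume) (f := φ) (g := ψ)
    (v := e)
    (Continuous.integrable_of_hasCompactSupport (by fun_prop) hcψ.mul_left)
    (Continuous.integrable_of_hasCompactSupport (by fun_prop) hc.mul_right)
    (Continuous.integrable_of_hasCompactSupport (by fun_prop) hc.mul_right)
    (fun x _ => hφ.differentiable (by simp) x) (fun x _ => hψ.differentiable (by simp) x)
  rw [this]
  simp only [mul_comm]

/-- The weak divergence identity for a radial field `k(|x|) x`. -/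
theorem IsWeakGradient.integral_radial_field (h : IsWeakGradient u G) {k : ℝ → ℝ}
    (hk : RayTest k) :
    ∫ x, u x * (N * k ‖x‖ + ‖x‖ * _root_.deriv k ‖x‖) = -∫ x, inner ℝ (k ‖x‖ • x) (G x) := by
  let e : Fin N → EuclideanSpace ℝ (Fin N) := EuclideanSpace.basisFun (Fin N) ℝ
  let X : Fin N → EuclideanSpace ℝ (Fin N) → ℝ := fun i x => k ‖x‖ * x i
  have hX (i) : ContDiff ℝ (⊤ : ℕ∞) (X i) := hk.contDiff_comp_norm.mul (by fun_prop)
  have hXc (i) : HasCompactSupport (X i) := hk.hasCompactSupport_comp_norm.mul_right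
  -- This is the divergence of `k(|x|) x`; the fields `X i` are its components.
  have hd (x : EuclideanSpace ℝ (Fin N)) :
      ∑ i, fderiv ℝ (X i) x (e i) = N * k ‖x‖ + ‖x‖ * _root_.deriv k ‖x‖ := by
    have h1 : HasFDerivAt (fun x : EuclideanSpace ℝ (Fin N) => k ‖x‖)
        ((_root_.deriv k ‖x‖ / ‖x‖) • innerSL ℝ x) x := by
      have := (hk.contDiff_comp_norm (N := N)).differentiable (by simp) x
      refine this.hasFDerivAt.congr_fderiv ?_
      ext v
      rw [← inner_gradient, hk.gradient_comp_norm, inner_smul_right]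
      simp [real_inner_comm]
    have h2 (i) : HasFDerivAt (X i) _ x :=
      h1.mul (EuclideanSpace.proj i : EuclideanSpace ℝ (Fin N) →L[ℝ] ℝ).hasFDerivAt
    simp only [(h2 _).fderiv]
    have e4 : ‖x‖ ^ 2 = ∑ i, x i ^ 2 := EuclideanSpace.real_norm_sq_eq x
    simp [e, Finset.sum_add_distrib, EuclideanSpace.inner_single_right]
    have e5 : ∀ i, x i * (_root_.deriv k ‖x‖ / ‖x‖ * x i) = _root_.deriv k ‖x‖ / ‖x‖ * x i ^ 2 :=
      fun i => by ring
    simp only [e5, ← Finset.mul_sum, ← e4]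
    rcases eq_or_ne ‖x‖ 0 with h0 | h0
    · simp [h0]
    · field_simp
  have hin (x : EuclideanSpace ℝ (Fin N)) :
      ∑ i, X i x * inner ℝ (e i) (G x) = inner ℝ (k ‖x‖ • x) (G x) := by
    rw [inner_smul_left, PiLp.inner_apply, Finset.mul_sum]
    refine Finset.sum_congr rfl fun i _ => ?_
    simp [X, e, EuclideanSpace.inner_single_left]
    ring
  simp only [← hd, ← hin, Finset.mul_sum]
  rw [integral_finsetSum _ fun i _ => ?_, integral_finsetSum _ fun i _ => ?_,
    ← Finset.sum_neg_distrib]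
  · exact Finset.sum_congr rfl fun i _ => h.integral_mul_fderiv (hX i) (hXc i) (e i)
  · have j := h.2.1.integrable_smul_left_of_hasCompactSupport (hX i).continuous (hXc i)
    simpa only [inner_smul_right] using j.const_inner (𝕜 := ℝ) (e i)
  · have hc : Continuous fun x => fderiv ℝ (X i) x (e i) := by
      have := (hX i).continuous_fderiv (by simp)
      fun_prop
    exact h.1.integrable_smul_right_of_hasCompactSupport hc ((hXc i).fderiv_apply (𝕜 := ℝ) (e i))

end

section

variable {N : ℕ}

/-! ### The radial lemma -/

/-- The profile of a radial function, read along the first coordinate axis. -/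
def profile (hN : 0 < N) (φ : EuclideanSpace ℝ (Fin N) → ℝ) (r : ℝ) : ℝ :=
  φ (r • EuclideanSpace.single ⟨0, hN⟩ 1)

theorem IsRadialTest.profile_norm (hN : 0 < N) {φ : EuclideanSpace ℝ (Fin N) → ℝ}
    (hφ : IsRadialTest φ) (x : EuclideanSpace ℝ (Fin N)) : profile hN φ ‖x‖ = φ x :=
  hφ.2.2 _ _ (by simp [norm_smul])

theorem IsRadialTest.contDiff_profile (hN : 0 < N) {φ : EuclideanSpace ℝ (Fin N) → ℝ}
    (hφ : IsRadialTest φ) : ContDiff ℝ (⊤ : ℕ∞) (profile hN φ) :=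
  hφ.1.comp (contDiff_id.smul contDiff_const)

theorem IsRadialTest.exists_profile_eq_zero (hN : 0 < N) {φ : EuclideanSpace ℝ (Fin N) → ℝ}
    (hφ : IsRadialTest φ) (r : ℝ) : ∃ R, r ≤ R ∧ profile hN φ R = 0 := by
  obtain ⟨M, hM⟩ := hφ.2.1.isCompact.isBounded.exists_norm_le
  refine ⟨max r (|M| + 1), le_max_left _ _, ?_⟩
  by_contra hne
  have h1 := hM _ (subset_tsupport _ (Function.mem_support.2 hne))
  rw [norm_smul, PiLp.norm_single, norm_one, mul_one, Real.norm_eq_abs] at h1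
  have h2 := (le_max_right r (|M| + 1)).trans (le_abs_self _)
  linarith [le_abs_self M]

theorem IsRadialTest.norm_gradient (hN : 0 < N) {φ : EuclideanSpace ℝ (Fin N) → ℝ}
    (hφ : IsRadialTest φ) {x : EuclideanSpace ℝ (Fin N)} (hx : x ≠ 0) :
    ‖gradient φ x‖ = |deriv (profile hN φ) ‖x‖| := by
  have h : φ = fun y => profile hN φ ‖y‖ := funext fun y => (hφ.profile_norm hN y).symm
  conv_lhs => rw [h]
  exact norm_gradient_comp_norm hx
    ((hφ.contDiff_profile hN).differentiable (by simp) _).hasDerivAt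

theorem ae_ne_zero (hN : 0 < N) : ∀ᵐ x : EuclideanSpace ℝ (Fin N), x ≠ 0 := by
  have : Nonempty (Fin N) := ⟨⟨0, hN⟩⟩
  have : Nontrivial (EuclideanSpace ℝ (Fin N)) := inferInstance
  exact Measure.ae_ne volume 0

theorem IsRadialTest.integral_norm_gradient_sq (hN : 0 < N)
    {φ : EuclideanSpace ℝ (Fin N) → ℝ} (hφ : IsRadialTest φ) :
    IntegrableOn (fun r => r ^ (N - 1) * deriv (profile hN φ) r ^ 2) (Ioi 0) ∧
    ∫ x, ‖gradient φ x‖ ^ 2 =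
      sphereConst N * ∫ r in Ioi 0, r ^ (N - 1) * deriv (profile hN φ) r ^ 2 := by
  have hae : (fun x => ‖gradient φ x‖ ^ 2) =ᵐ[volume]
      fun x => (fun r => deriv (profile hN φ) r ^ 2) ‖x‖ := by
    filter_upwards [ae_ne_zero hN] with x hx
    rw [hφ.norm_gradient hN hx, sq_abs]
  constructor
  · have hi : Integrable fun x => ‖gradient φ x‖ ^ 2 :=
      MemLp.integrable_norm_pow (p := 2) ((continuous_gradient hφ.1).memLp_of_hasCompactSupport
        (hasCompactSupport_gradient hφ.2.1)) two_ne_zero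
    exact (integrable_comp_norm hN (F := fun r => deriv (profile hN φ) r ^ 2)).1
      ((integrable_congr hae).1 hi)
  · rw [integral_congr_ae hae, integral_comp_norm hN fun r => deriv (profile hN φ) r ^ 2]

theorem integrableOn_inv_pow {m : ℕ} (hm : 2 ≤ m) {a : ℝ} (ha : 0 < a) :
    IntegrableOn (fun r : ℝ => (r ^ m)⁻¹) (Ioi a) := by
  have h := integrableOn_Ioi_rpow_of_lt (a := -(m : ℝ)) (c := a) (by
    have : (2 : ℝ) ≤ m := by exact_mod_cast hm
    linarith) ha
  refine h.congr_fun (fun r hr => ?_) measurableSet_Ioi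
  simp only [Real.rpow_neg (ha.trans hr).le, Real.rpow_natCast]

/-- The radial lemma: a radial test function is bounded outside a ball by its Dirichlet energy. -/
theorem exists_sq_le_integral_norm_gradient_sq (hN : 3 ≤ N) {a : ℝ} (ha : 0 < a) :
    ∃ C : ℝ, 0 < C ∧ ∀ φ : EuclideanSpace ℝ (Fin N) → ℝ, IsRadialTest φ → ∀ x, a ≤ ‖x‖ →
      φ x ^ 2 ≤ C * ∫ x, ‖gradient φ x‖ ^ 2 := by
  have hN0 : 0 < N := by omega
  have hc := sphereConst_pos hN0
  have hi := integrableOn_inv_pow (m := N - 1) (by omega) ha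
  set c := sphereConst N
  set J := ∫ r in Ioi a, (r ^ (N - 1))⁻¹
  have hJ : 0 ≤ J := setIntegral_nonneg measurableSet_Ioi fun r hr =>
    inv_nonneg.2 (pow_nonneg (ha.trans hr).le _)
  -- Using `J + 1` rather than `J` avoids having to show `J > 0` when dividing.
  refine ⟨(J + 1) / c, by positivity, fun φ hφ x hx => ?_⟩
  obtain ⟨hE, hEq⟩ := hφ.integral_norm_gradient_sq hN0
  set Φ := profile hN0 φ
  set E := ∫ r in Ioi 0, r ^ (N - 1) * deriv Φ r ^ 2
  have hΦ := hφ.contDiff_profile hN0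
  have hΦ' : Continuous (deriv Φ) := hΦ.continuous_deriv (by simp)
  rw [hEq, ← hφ.profile_norm hN0]
  have e : (J + 1) / c * (c * E) = (J + 1) * E := by field_simp
  rw [e]
  set r := ‖x‖
  obtain ⟨R, hrR, hR⟩ := hφ.exists_profile_eq_zero hN0 r
  -- Cauchy-Schwarz in the form of a weighted Young inequality: `2|Φ'| ≤ l s^(1-N) + s^(N-1) Φ'² /
  -- l`, the difference being a perfect square. The parameter is later taken as `l = |Φ r| / (J +
  -- 1)`.
  have key (l : ℝ) (hl : 0 < l) : 2 * |Φ r| ≤ l * J + E / l := by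
    have h1 : ∫ s in r..R, deriv Φ s = Φ R - Φ r :=
      intervalIntegral.integral_deriv_eq_sub (fun s _ => hΦ.differentiable (by simp) s)
        (hΦ'.intervalIntegrable _ _)
    have h2 : |Φ r| ≤ ∫ s in r..R, |deriv Φ s| := by
      have h3 : Φ R = 0 := hR
      rw [show Φ r = -∫ s in r..R, deriv Φ s by rw [h1, h3]; ring, abs_neg]
      exact intervalIntegral.abs_integral_le_integral_abs hrR
    have hsub : Ioc r R ⊆ Ioi a := fun s hs => lt_of_le_of_lt hx hs.1
    have hsub0 : Ioc r R ⊆ Ioi 0 := fun s hs => ha.trans (hsub hs)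
    have h4 : ∫ s in r..R, 2 * |deriv Φ s| ≤ ∫ s in r..R,
        (l * (s ^ (N - 1))⁻¹ + (s ^ (N - 1) * deriv Φ s ^ 2) / l) := by
      rw [intervalIntegral.integral_of_le hrR, intervalIntegral.integral_of_le hrR]
      refine setIntegral_mono_on ?_ ?_ measurableSet_Ioc fun s hs => ?_
      · exact ((hΦ'.abs.const_mul 2).integrableOn_Icc).mono_set Ioc_subset_Icc_self
      · exact ((hi.mono_set hsub).const_mul l).add ((hE.mono_set hsub0).div_const l)
      · have hp : 0 < s ^ (N - 1) := pow_pos (hsub0 hs) _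
        have h5 := sq_nonneg (l - s ^ (N - 1) * |deriv Φ s|)
        have h6 : l * (s ^ (N - 1))⁻¹ + (s ^ (N - 1) * deriv Φ s ^ 2) / l - 2 * |deriv Φ s| =
            (l - s ^ (N - 1) * |deriv Φ s|) ^ 2 / (l * s ^ (N - 1)) := by
          rw [← sq_abs (deriv Φ s)]
          field_simp
          ring
        have h7 : 0 ≤ (l - s ^ (N - 1) * |deriv Φ s|) ^ 2 / (l * s ^ (N - 1)) := by positivity
        linarith
    rw [intervalIntegral.integral_const_mul, intervalIntegral.integral_of_le hrR,
      intervalIntegral.integral_of_le hrR,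
      integral_add ((hi.mono_set hsub).const_mul l) ((hE.mono_set hsub0).div_const l),
      integral_const_mul, integral_div] at h4
    have h8 : ∫ s in Ioc r R, (s ^ (N - 1))⁻¹ ≤ J :=
      setIntegral_mono_set hi ((ae_restrict_iff' measurableSet_Ioi).2 (Eventually.of_forall
        fun s hs => inv_nonneg.2 (pow_nonneg (ha.trans hs).le _))) hsub.eventuallyLE
    have h9 : ∫ s in Ioc r R, s ^ (N - 1) * deriv Φ s ^ 2 ≤ E :=
      setIntegral_mono_set hE ((ae_restrict_iff' measurableSet_Ioi).2 (Eventually.of_forall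
        fun s hs => mul_nonneg (pow_nonneg (le_of_lt hs) _) (sq_nonneg _))) hsub0.eventuallyLE
    rw [intervalIntegral.integral_of_le hrR] at h2
    have h10 := mul_le_mul_of_nonneg_left h8 hl.le
    have h11 := div_le_div_of_nonneg_right h9 hl.le
    linarith
  have hE0 : 0 ≤ E := setIntegral_nonneg measurableSet_Ioi fun s hs =>
    mul_nonneg (pow_nonneg (le_of_lt hs) _) (sq_nonneg _)
  rcases (abs_nonneg (Φ r)).eq_or_lt with h0 | h0
  · rw [← sq_abs, ← h0, zero_pow two_ne_zero]
    exact mul_nonneg (by linarith) hE0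
  · have h1 := key (|Φ r| / (J + 1)) (by positivity)
    have h2 : |Φ r| / (J + 1) * J ≤ |Φ r| := by
      rw [div_mul_eq_mul_div, div_le_iff₀ (by positivity)]
      nlinarith
    have h3 : |Φ r| ≤ E / (|Φ r| / (J + 1)) := by linarith
    rw [div_div_eq_mul_div, le_div_iff₀ h0] at h3
    rw [← sq_abs]
    linarith

theorem exists_enorm_le_eLpNorm_gradient (hN : 3 ≤ N) {a : ℝ} (ha : 0 < a) :
    ∃ C : ℝ≥0∞, C ≠ ⊤ ∧ ∀ φ : EuclideanSpace ℝ (Fin N) → ℝ, IsRadialTest φ → ∀ x, a ≤ ‖x‖ →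
      ‖φ x‖ₑ ≤ C * eLpNorm (gradient φ) 2 volume := by
  obtain ⟨C, hC, h⟩ := exists_sq_le_integral_norm_gradient_sq hN ha
  refine ⟨ENNReal.ofReal (√C), ENNReal.ofReal_ne_top, fun φ hφ x hx => ?_⟩
  have hm : MemLp (gradient φ) 2 volume :=
    (continuous_gradient hφ.1).memLp_of_hasCompactSupport (hasCompactSupport_gradient hφ.2.1)
  rw [hm.eLpNorm_eq_integral_rpow_norm (by simp) (by simp), ← ENNReal.ofReal_mul (by positivity),
    ← ofReal_norm]
  refine ENNReal.ofReal_le_ofReal ?_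
  have e : (∫ x, ‖gradient φ x‖ ^ (2 : ℝ≥0∞).toReal) ^ ((2 : ℝ≥0∞).toReal)⁻¹ =
      √(∫ x, ‖gradient φ x‖ ^ 2) := by
    rw [Real.sqrt_eq_rpow]
    norm_num
  rw [e, ← Real.sqrt_mul hC.le, Real.norm_eq_abs]
  exact Real.abs_le_sqrt (h φ hφ x hx)

theorem IsRadialTest.sub {φ ψ : EuclideanSpace ℝ (Fin N) → ℝ} (hφ : IsRadialTest φ)
    (hψ : IsRadialTest ψ) : IsRadialTest fun x => φ x - ψ x :=
  ⟨hφ.1.sub hψ.1, hφ.2.1.sub hψ.2.1, fun x y h => by simp only [hφ.2.2 x y h, hψ.2.2 x y h]⟩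

theorem gradient_sub {φ ψ : EuclideanSpace ℝ (Fin N) → ℝ} (hφ : ContDiff ℝ (⊤ : ℕ∞) φ)
    (hψ : ContDiff ℝ (⊤ : ℕ∞) ψ) (x : EuclideanSpace ℝ (Fin N)) :
    gradient (fun x => φ x - ψ x) x = gradient φ x - gradient ψ x := by
  rw [gradient, gradient, gradient, ← map_sub,
    fderiv_fun_sub (hφ.differentiable (by simp) x) (hψ.differentiable (by simp) x)]

theorem gradient_const_mul {φ : EuclideanSpace ℝ (Fin N) → ℝ} (hφ : ContDiff ℝ (⊤ : ℕ∞) φ)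
    (c : ℝ) (x : EuclideanSpace ℝ (Fin N)) :
    gradient (fun x => c * φ x) x = c • gradient φ x := by
  rw [gradient, gradient, fderiv_const_mul (hφ.differentiable (by simp) x) c, map_smulₛₗ]
  simp

theorem critExp_ne_zero (hN : 3 ≤ N) : critExp N ≠ 0 := by
  have : (3 : ℝ) ≤ N := by exact_mod_cast hN
  rw [critExp, ne_eq, ENNReal.ofReal_eq_zero, not_le]
  exact div_pos (by linarith) (by linarith)

variable {u : EuclideanSpace ℝ (Fin N) → ℝ}

/-- Elements of `D_r^{1,2}` have a radial representative, continuous away from the origin, which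
vanishes when the weak gradient does. -/
theorem MemD.exists_continuousOn_profile (hN : 3 ≤ N) (hu : MemD u) :
    ∃ U : ℝ → ℝ, ContinuousOn U (Ioi 0) ∧ u =ᵐ[volume] (fun x => U ‖x‖) ∧
      (weakGrad u =ᵐ[volume] 0 → ∀ r, 0 < r → U r = 0) := by
  have hN0 : 0 < N := by omega
  obtain ⟨hLp, -, hG, φ, hφ, h1, h2⟩ := hu
  let e : EuclideanSpace ℝ (Fin N) := EuclideanSpace.single ⟨0, hN0⟩ 1
  have he (r : ℝ) (hr : 0 < r) : ‖r • e‖ = r := by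
    simp [norm_smul, e, abs_of_pos hr]
  have hm (n) : AEStronglyMeasurable (gradient (φ n)) volume :=
    (continuous_gradient (hφ n).1).aestronglyMeasurable
  set δ : ℕ → ℝ≥0∞ := fun n => eLpNorm (fun x => gradient (φ n) x - weakGrad u x) 2 volume
  have hδ (m n : ℕ) : eLpNorm (gradient fun x => φ m x - φ n x) 2 volume ≤ δ m + δ n := by
    have e1 : (gradient fun x => φ m x - φ n x) =
        (fun x => gradient (φ m) x - weakGrad u x) - fun x => gradient (φ n) x - weakGrad u x := by
      funext x
      rw [gradient_sub (hφ m).1 (hφ n).1]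
      simp
    rw [e1]
    exact eLpNorm_sub_le ((hm m).sub hG.1) ((hm n).sub hG.1) (by norm_num)
  -- The radial lemma applied to differences of the approximating functions turns convergence of
  -- gradients in `L²` into uniform convergence of profiles away from the origin.
  have hcau (a : ℝ) (ha : 0 < a) :
      UniformCauchySeqOn (fun n => profile hN0 (φ n)) atTop (Ici a) := by
    obtain ⟨C, hC, hb⟩ := exists_enorm_le_eLpNorm_gradient hN ha
    rw [Metric.uniformCauchySeqOn_iff]
    intro ε hε
    have ht : Tendsto (fun n => C * δ n) atTop (𝓝 0) := by
      simpa using ENNReal.Tendsto.const_mul h2 (Or.inr hC)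
    obtain ⟨M, hM⟩ := eventually_atTop.1
      (ht.eventually_lt_const (ENNReal.ofReal_pos.2 (half_pos hε)))
    refine ⟨M, fun m hm n hn r hr => ?_⟩
    have hr0 : 0 < r := ha.trans_le hr
    have h3 := hb _ ((hφ m).sub (hφ n)) (r • e) (by rw [he r hr0]; exact hr)
    have h4 : C * (δ m + δ n) < ENNReal.ofReal ε := by
      rw [mul_add, ← add_halves ε, ENNReal.ofReal_add (half_pos hε).le (half_pos hε).le]
      exact ENNReal.add_lt_add (hM m hm) (hM n hn)
    have h5 := (h3.trans (mul_le_mul_right (hδ m n) C)).trans_lt h4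
    rw [← ofReal_norm, ENNReal.ofReal_lt_ofReal_iff hε] at h5
    exact h5
  have hlim (r : ℝ) (hr : 0 < r) : ∃ l, Tendsto (fun n => profile hN0 (φ n) r) atTop (𝓝 l) :=
    cauchySeq_tendsto_of_complete ((hcau r hr).cauchySeq self_mem_Ici)
  choose! U hU using hlim
  refine ⟨U, fun r hr => ?_, ?_, fun hz r hr => ?_⟩
  · have hr2 : 0 < r / 2 := half_pos hr
    have hunif := (hcau (r / 2) hr2).tendstoUniformlyOn_of_tendsto
      fun s hs => hU s (hr2.trans_le hs)
    have hc := hunif.continuousOn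
      (Eventually.of_forall fun n => ((hφ n).contDiff_profile hN0).continuous.continuousOn).frequently
    exact (hc.continuousAt (Ici_mem_nhds (half_lt_self hr))).continuousWithinAt
  -- Convergence in `L^{2*}` gives a.e. convergence of a subsequence, which identifies the uniform
  -- limit with `u`.
  · obtain ⟨ns, hns, hae⟩ := (tendstoInMeasure_of_tendsto_eLpNorm (critExp_ne_zero hN)
      (fun n => (hφ n).1.continuous.aestronglyMeasurable) hLp.1 h1).exists_seq_tendsto_ae
    filter_upwards [hae, ae_ne_zero hN0] with x hx hx0
    have h3 := (hU ‖x‖ (norm_pos_iff.2 hx0)).comp hns.tendsto_atTop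
    simp only [Function.comp_def, (hφ _).profile_norm hN0] at h3
    exact tendsto_nhds_unique hx h3
  -- When the weak gradient vanishes, `δ n` is the gradient norm of `φ n` itself, so the profiles
  -- tend to zero.
  · obtain ⟨C, hC, hb⟩ := exists_enorm_le_eLpNorm_gradient hN hr
    have ht : Tendsto (fun n => C * δ n) atTop (𝓝 0) := by
      simpa using ENNReal.Tendsto.const_mul h2 (Or.inr hC)
    have h3 (n) : ‖profile hN0 (φ n) r‖ₑ ≤ C * δ n := by
      refine (hb _ (hφ n) (r • e) (he r hr).ge).trans_eq ?_
      congr 1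
      refine eLpNorm_congr_ae ?_
      filter_upwards [hz] with x hx
      simp [hx]
    have h4 : Tendsto (fun n => ‖profile hN0 (φ n) r‖ₑ) atTop (𝓝 0) :=
      tendsto_of_tendsto_of_tendsto_of_le_of_le tendsto_const_nhds ht (fun _ => zero_le) h3
    rw [tendsto_zero_iff_enorm_tendsto_zero.symm] at h4
    exact tendsto_nhds_unique (hU r hr) h4

/-! ### Homogeneity of the norm and radial test directions -/

theorem MemD.isWeakGradient (hu : MemD u) : IsWeakGradient u (weakGrad u) :=
  isWeakGradient_weakGrad hu.2.1

theorem weakGrad_const_mul (hu : MemD u) (c : ℝ) :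
    weakGrad (fun x => c * u x) =ᵐ[volume] fun x => c • weakGrad u x := by
  have := hu.isWeakGradient.add_smul hu.isWeakGradient c 0
  simp only [zero_mul, add_zero, zero_smul] at this
  exact this.weakGrad_ae_eq

theorem MemD.const_mul (hu : MemD u) (c : ℝ) : MemD fun x => c * u x := by
  have hw := weakGrad_const_mul hu c
  have h0 := hu.isWeakGradient.add_smul hu.isWeakGradient c 0
  simp only [zero_mul, add_zero, zero_smul] at h0
  obtain ⟨h1, -, h3, φ, hφ, h4, h5⟩ := hu
  refine ⟨h1.const_mul c, ⟨_, h0⟩, (memLp_congr_ae hw).2 (h3.const_smul c),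
    fun n x => c * φ n x, fun n => ⟨contDiff_const.mul (hφ n).1, (hφ n).2.1.mul_left,
      fun x y h => by simp only [(hφ n).2.2 x y h]⟩, ?_, ?_⟩
  · have e (n) : (fun x => c * φ n x - c * u x) = c • fun x => φ n x - u x := by
      funext x; simp [mul_sub]
    simp only [e, eLpNorm_const_smul]
    simpa using ENNReal.Tendsto.const_mul h4 (Or.inr enorm_ne_top)
  · have e (n) : eLpNorm (fun x => gradient (fun x => c * φ n x) x - weakGrad (fun x => c * u x) x)
        2 volume = eLpNorm (c • fun x => gradient (φ n) x - weakGrad u x) 2 volume := by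
      refine eLpNorm_congr_ae ?_
      filter_upwards [hw] with x hx
      rw [hx, gradient_const_mul (hφ n).1]
      simp [smul_sub]
    simp only [e, eLpNorm_const_smul]
    simpa using ENNReal.Tendsto.const_mul h5 (Or.inr enorm_ne_top)

theorem MemE.const_mul (hN : 0 < N) {V : ℝ → ℝ} (hV : ∀ r, 0 < r → 0 ≤ V r) (hu : MemE V u)
    {c : ℝ} (hc : 0 < c) : MemE V fun x => c * u x := by
  refine ⟨hu.1.const_mul c, ?_⟩
  have h : modular V (fun x => c * u x) ≤ ENNReal.ofReal (max 1 c ^ 2) * modular V u := by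
    rw [modular, modular, ← lintegral_const_mul' _ _ ENNReal.ofReal_ne_top]
    refine lintegral_mono_ae ?_
    filter_upwards [ae_ne_zero hN] with x hx
    rw [← ENNReal.ofReal_mul (by positivity)]
    refine ENNReal.ofReal_le_ofReal ?_
    have h1 := pow_le_pow_left₀ (abs_nonneg _) (abs_f_mul_le hc (u x)) 2
    rw [mul_pow, sq_abs, sq_abs] at h1
    nlinarith [hV _ (norm_pos_iff.2 hx)]
  exact h.trans_lt (ENNReal.mul_lt_top ENNReal.ofReal_lt_top hu.2)

theorem normD_const_mul (hu : MemD u) {c : ℝ} (hc : 0 < c) :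
    normD (fun x => c * u x) = c * normD u := by
  have h : (fun x => ‖weakGrad (fun x => c * u x) x‖ ^ 2) =ᵐ[volume]
      fun x => c ^ 2 * ‖weakGrad u x‖ ^ 2 := by
    filter_upwards [weakGrad_const_mul hu c] with x hx
    rw [hx, norm_smul, mul_pow, Real.norm_eq_abs, sq_abs]
  rw [normD, normD, integral_congr_ae h, integral_const_mul, Real.sqrt_mul (sq_nonneg c),
    Real.sqrt_sq hc.le]

/-- Replacing `k` by `k / c` in the infimum gives one inequality for every `c > 0`; applying it with
`c⁻¹` gives the other. -/
theorem normO_const_mul (V : ℝ → ℝ) (u : EuclideanSpace ℝ (Fin N) → ℝ) {c : ℝ} (hc : 0 < c) :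
    normO V (fun x => c * u x) = c * normO V u := by
  let J : (EuclideanSpace ℝ (Fin N) → ℝ) → ℝ≥0∞ := fun u =>
    ⨅ (k : ℝ) (_ : 0 < k), ENNReal.ofReal (1 / k) * (1 + modular V (fun x => k * u x))
  have hle (u : EuclideanSpace ℝ (Fin N) → ℝ) (c : ℝ) (hc : 0 < c) :
      J (fun x => c * u x) ≤ ENNReal.ofReal c * J u := by
    have hc0 : ENNReal.ofReal c ≠ 0 := (ENNReal.ofReal_pos.2 hc).ne'
    simp only [J]
    rw [ENNReal.mul_iInf_of_ne hc0 ENNReal.ofReal_ne_top]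
    refine le_iInf fun k => ?_
    rw [ENNReal.mul_iInf_of_ne hc0 ENNReal.ofReal_ne_top]
    refine le_iInf fun hk => iInf₂_le_of_le (k / c) (div_pos hk hc) (le_of_eq ?_)
    have e (x) : k / c * (c * u x) = k * u x := by field_simp
    simp only [e]
    rw [← mul_assoc, ← ENNReal.ofReal_mul hc.le]
    congr 2
    field_simp
  have heq : J (fun x => c * u x) = ENNReal.ofReal c * J u := by
    refine (hle u c hc).antisymm ?_
    have h := hle (fun x => c * u x) c⁻¹ (inv_pos.2 hc)
    have e (x) : c⁻¹ * (c * u x) = u x := inv_mul_cancel_left₀ hc.ne' _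
    simp only [e] at h
    calc _ ≤ ENNReal.ofReal c * (ENNReal.ofReal c⁻¹ * J fun x => c * u x) := by gcongr
      _ = _ := by
        rw [← mul_assoc, ← ENNReal.ofReal_mul hc.le, mul_inv_cancel₀ hc.ne', ENNReal.ofReal_one,
          one_mul]
  have := congrArg ENNReal.toReal heq
  rwa [ENNReal.toReal_mul, ENNReal.toReal_ofReal hc.le] at this

theorem normE_const_mul {V : ℝ → ℝ} (hu : MemD u) {c : ℝ} (hc : 0 < c) :
    normE V (fun x => c * u x) = c * normE V u := by
  rw [normE, normE, normD_const_mul hu hc, normO_const_mul V u hc, mul_add]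

theorem RayTest.memD {η : ℝ → ℝ} (hη : RayTest η) :
    MemD fun x : EuclideanSpace ℝ (Fin N) => η ‖x‖ := by
  have h := hη.isRadialTest (N := N)
  have hw := isWeakGradient_gradient h.1 h.2.1
  refine ⟨h.1.continuous.memLp_of_hasCompactSupport h.2.1, ⟨_, hw⟩,
    (memLp_congr_ae hw.weakGrad_ae_eq).2
      ((continuous_gradient h.1).memLp_of_hasCompactSupport (hasCompactSupport_gradient h.2.1)),
    fun _ => _, fun _ => h, by simp, ?_⟩
  have e : eLpNorm (fun x => gradient (fun x : EuclideanSpace ℝ (Fin N) => η ‖x‖) x -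
      weakGrad (fun x : EuclideanSpace ℝ (Fin N) => η ‖x‖) x) 2 volume = 0 := by
    rw [← eLpNorm_zero (p := 2) (μ := (volume : Measure (EuclideanSpace ℝ (Fin N))))
      (ε := EuclideanSpace ℝ (Fin N))]
    refine eLpNorm_congr_ae ?_
    filter_upwards [hw.weakGrad_ae_eq] with x hx
    simp [hx]
  exact tendsto_const_nhds.congr fun _ => e.symm

theorem RayTest.memE (hN : 0 < N) {η : ℝ → ℝ} (hη : RayTest η) {V : ℝ → ℝ}
    (hV : ∀ r, 0 < r → 0 ≤ V r) (hVc : ContinuousOn V (Ioi 0)) :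
    MemE V fun x : EuclideanSpace ℝ (Fin N) => η ‖x‖ := by
  refine ⟨hη.memD, ?_⟩
  have hi : Integrable (fun x : EuclideanSpace ℝ (Fin N) => (fun r => V r * η r ^ 2) ‖x‖) := by
    refine (integrable_comp_norm hN (F := fun r => V r * η r ^ 2)).2 ?_
    have h := hη.integrable_mul (W := fun r => r ^ (N - 1) * (V r * η r))
      ((continuousOn_id.pow _).mul (hVc.mul hη.1.continuous.continuousOn))
    refine (h.integrableOn (s := Ioi 0)).congr (Eventually.of_forall fun r => ?_)
    ring
  refine lt_of_le_of_lt (lintegral_mono_ae ?_) hi.lintegral_lt_top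
  filter_upwards [ae_ne_zero hN] with x hx
  refine ENNReal.ofReal_le_ofReal (mul_le_mul_of_nonneg_left ?_ (hV _ (norm_pos_iff.2 hx)))
  exact sq_le_sq.2 (abs_f_le _)

/-- Finiteness on the unit sphere of `E` propagates to all of `E`. -/
theorem lintegral_rpow_lt_top_of_unit (hN : 0 < N) {V K : ℝ → ℝ} (hV : ∀ r, 0 < r → 0 ≤ V r)
    (s : Set (EuclideanSpace ℝ (Fin N))) {q : ℝ}
    (hfin : (⨆ (v : EuclideanSpace ℝ (Fin N) → ℝ) (_ : MemE V v ∧ normE V v = 1),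
      ∫⁻ x in s, ENNReal.ofReal (K ‖x‖ * |v x| ^ q)) < ⊤) (hu : MemE V u) (hpos : 0 < normE V u) :
    ∫⁻ x in s, ENNReal.ofReal (K ‖x‖ * |u x| ^ q) < ⊤ := by
  set c := (normE V u)⁻¹ with hc
  have hc0 : 0 < c := inv_pos.2 hpos
  have hv : MemE V (fun x => c * u x) ∧ normE V (fun x => c * u x) = 1 :=
    ⟨hu.const_mul hN hV hc0, by rw [normE_const_mul hu.1 hc0, inv_mul_cancel₀ hpos.ne']⟩
  have h := lt_of_le_of_lt (le_iSup₂ (f := fun (v : EuclideanSpace ℝ (Fin N) → ℝ)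
    (_ : MemE V v ∧ normE V v = 1) => ∫⁻ x in s, ENNReal.ofReal (K ‖x‖ * |v x| ^ q)) _ hv) hfin
  have hcq : 0 < c ^ q := Real.rpow_pos_of_pos hc0 q
  have e (x) : ENNReal.ofReal (K ‖x‖ * |c * u x| ^ q) =
      ENNReal.ofReal (c ^ q) * ENNReal.ofReal (K ‖x‖ * |u x| ^ q) := by
    rw [← ENNReal.ofReal_mul hcq.le, abs_mul, abs_of_pos hc0,
      Real.mul_rpow hc0.le (abs_nonneg _)]
    ring_nf
  simp only [e] at h
  rw [lintegral_const_mul' _ _ ENNReal.ofReal_ne_top] at h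
  exact ENNReal.lt_top_of_mul_ne_top_right h.ne (ENNReal.ofReal_pos.2 hcq).ne'

/-- A function of norm zero cannot be rescaled to the unit sphere, where `CondS'` applies. Here its
gradient is shown to vanish, so its profile does too. -/
theorem weakGrad_ae_eq_zero_of_normE_eq_zero {V : ℝ → ℝ} (hu : MemD u) (h : normE V u = 0) :
    weakGrad u =ᵐ[volume] 0 := by
  have h1 : 0 ≤ normD u := Real.sqrt_nonneg _
  have h2 : 0 ≤ normO V u := ENNReal.toReal_nonneg
  have h3 : normD u = 0 := by rw [normE] at h; linarith
  have h4 : 0 ≤ ∫ x, ‖weakGrad u x‖ ^ 2 := integral_nonneg fun x => by positivity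
  rw [normD, Real.sqrt_eq_zero h4,
    integral_eq_zero_iff_of_nonneg (fun x => by positivity) (hu.2.2.1.integrable_norm_pow (by simp))]
    at h3
  filter_upwards [h3] with x hx
  simpa using hx

end

section

variable {N : ℕ} {V K g U η : ℝ → ℝ}

/-! ### The first variation of the energy in radial directions -/

theorem aestronglyMeasurable_comp_norm (hN : 0 < N) {F : ℝ → ℝ} (hF : ContinuousOn F (Ioi 0)) :
    AEStronglyMeasurable (fun x : EuclideanSpace ℝ (Fin N) => F ‖x‖) volume := by
  have : Nonempty (Fin N) := ⟨⟨0, hN⟩⟩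
  have : Nontrivial (EuclideanSpace ℝ (Fin N)) := inferInstance
  have h : ContinuousOn (fun x : EuclideanSpace ℝ (Fin N) => F ‖x‖) {0}ᶜ :=
    hF.comp continuous_norm.continuousOn fun x hx => norm_pos_iff.2 hx
  have h1 := h.aestronglyMeasurable (μ := volume) (measurableSet_singleton 0).compl
  rwa [restrict_compl_singleton] at h1

/-- Differentiation of a superposition functional in a radial test direction. -/
theorem hasDerivAt_integral_superposition (hN : 0 < N) {κ H H' : ℝ → ℝ}
    (hκ : ContinuousOn κ (Ioi 0)) (hU : ContinuousOn U (Ioi 0)) (hη : RayTest η)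
    (hH : ∀ t, HasDerivAt H (H' t) t) (hH' : Continuous H')
    (hint : Integrable fun x : EuclideanSpace ℝ (Fin N) => κ ‖x‖ * H (U ‖x‖)) :
    HasDerivAt (fun s : ℝ => ∫ x : EuclideanSpace ℝ (Fin N), κ ‖x‖ * H (U ‖x‖ + s * η ‖x‖))
      (sphereConst N * ∫ r, r ^ (N - 1) * (κ r * H' (U r)) * η r) 0 := by
  have hHc : Continuous H := continuous_iff_continuousAt.2 fun t => (hH t).continuousAt
  have hηc := hη.1.continuous
  have e (s : ℝ) := integral_comp_norm hN fun r => κ r * H (U r + s * η r)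
  simp only [e]
  refine HasDerivAt.const_mul _ ?_
  have hint' := (integrable_comp_norm hN (F := fun r => κ r * H (U r))).1 hint
  obtain ⟨-, a, b, ha, hab, hz⟩ := id hη
  have hp : ContinuousOn (fun r : ℝ => r ^ (N - 1)) (Ioi 0) := by fun_prop
  have hcF (s : ℝ) : ContinuousOn (fun r => r ^ (N - 1) * (κ r * H (U r + s * η r))) (Ioi 0) :=
    hp.mul (hκ.mul (hHc.comp_continuousOn (hU.add (by fun_prop))))
  let F' : ℝ → ℝ → ℝ := fun s r => r ^ (N - 1) * (κ r * (H' (U r + s * η r) * η r))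
  have hcF' (s : ℝ) : ContinuousOn (F' s) (Ioi 0) :=
    hp.mul (hκ.mul ((hH'.comp_continuousOn (hU.add (by fun_prop))).mul (by fun_prop)))
  have hsub : Icc a b ⊆ Ioi 0 := fun r hr => ha.trans_le hr.1
  -- `F'` vanishes for `r` outside `[a, b]`, so its maximum on a compact rectangle is a dominating
  -- constant. The undifferentiated integrand has to be integrable only at `s = 0`.
  obtain ⟨M, hM⟩ : ∃ M, ∀ z ∈ Icc a b ×ˢ Icc (-1 : ℝ) 1, ‖F' z.2 z.1‖ ≤ M := by
    refine (isCompact_Icc.prod isCompact_Icc).exists_bound_of_continuousOn ?_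
    have hm : MapsTo (Prod.fst : ℝ × ℝ → ℝ) (Icc a b ×ˢ Icc (-1 : ℝ) 1) (Ioi 0) :=
      fun z hz => hsub hz.1
    have h1 := hp.comp continuousOn_fst hm
    have h2 := hκ.comp continuousOn_fst hm
    have h3 := hU.comp continuousOn_fst hm
    exact h1.mul (h2.mul ((hH'.comp_continuousOn (h3.add (by fun_prop))).mul (by fun_prop)))
  have hM0 : 0 ≤ M := (norm_nonneg _).trans
    (hM (a, 0) ⟨⟨le_rfl, hab.le⟩, by norm_num, by norm_num⟩)
  have hd := (hasDerivAt_integral_of_dominated_loc_of_deriv_le (μ := volume.restrict (Ioi 0))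
    (F := fun s r => r ^ (N - 1) * (κ r * H (U r + s * η r))) (F' := F') (x₀ := 0)
    (s := Icc (-1) 1) (bound := (Icc a b).indicator fun _ => M)
    (Icc_mem_nhds (by norm_num) (by norm_num))
    (Eventually.of_forall fun s => (hcF s).aestronglyMeasurable measurableSet_Ioi)
    (by simpa [IntegrableOn] using hint') ((hcF' 0).aestronglyMeasurable measurableSet_Ioi)
    (Eventually.of_forall fun r s hs => ?_) ?_ (Eventually.of_forall fun r s _ => ?_)).2
  · refine hd.congr_deriv ?_
    rw [← hη.setIntegral_Ioi]
    refine setIntegral_congr_fun measurableSet_Ioi fun r _ => ?_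
    simp only [F', zero_mul, add_zero]
    ring
  · by_cases hr : r ∈ Icc a b
    · rw [indicator_of_mem hr]
      exact hM (r, s) ⟨hr, hs⟩
    · rw [mem_Icc, not_and_or, not_le, not_le] at hr
      have h0 : F' s r = 0 := by simp [F', hz r (hr.imp le_of_lt le_of_lt)]
      rw [h0, norm_zero]
      exact indicator_nonneg (fun _ _ => hM0) r
  · exact (integrable_indicator_iff measurableSet_Icc).2
      (integrableOn_const (by simp)) |>.restrict
  · have h1 : HasDerivAt (fun s : ℝ => U r + s * η r) (η r) s := by
      simpa using ((hasDerivAt_id s).mul_const (η r)).const_add (U r)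
    exact (((hH _).comp s h1).const_mul _).const_mul _

/-- This is the factor `k` for which the gradient of `η(|x|)` is `k(|x|) x`. -/
theorem RayTest.deriv_div (hη : RayTest η) : RayTest fun r => _root_.deriv η r / r := by
  have := hη.deriv.smul_contDiffAt (q := fun r => r⁻¹) fun r hr => contDiffAt_inv ℝ hr.ne'
  simpa only [div_eq_inv_mul] using this

variable {u : EuclideanSpace ℝ (Fin N) → ℝ}

/-- Differentiation of the Dirichlet energy in a radial test direction. -/
theorem hasDerivAt_dirichlet (hN : 0 < N) (hu : MemD u) (huU : u =ᵐ[volume] fun x => U ‖x‖)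
    (hη : RayTest η) :
    HasDerivAt (fun s : ℝ => ∫ x, ‖weakGrad (fun x => u x + s * η ‖x‖) x‖ ^ 2)
      (-(2 * (sphereConst N * ∫ r, U r * deriv (fun r => r ^ (N - 1) * deriv η r) r))) 0 := by
  have ht := hη.isRadialTest (N := N)
  set h : EuclideanSpace ℝ (Fin N) → ℝ := fun x => η ‖x‖
  have hgm : MemLp (gradient h) 2 volume :=
    (continuous_gradient ht.1).memLp_of_hasCompactSupport (hasCompactSupport_gradient ht.2.1)
  have hG := hu.2.2.1
  have i1 := hG.integrable_norm_pow (p := 2) two_ne_zero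
  have i2 := hgm.integrable_norm_pow (p := 2) two_ne_zero
  have i3 : Integrable fun x => inner ℝ (weakGrad u x) (gradient h x) := by
    refine (L2.integrable_inner (𝕜 := ℝ) hG.toLp hgm.toLp).congr ?_
    filter_upwards [MemLp.coeFn_toLp hG, MemLp.coeFn_toLp hgm] with x h1 h2
    rw [h1, h2]
  have e (s : ℝ) : ∫ x, ‖weakGrad (fun x => u x + s * η ‖x‖) x‖ ^ 2 =
      (∫ x, ‖weakGrad u x‖ ^ 2) + s * (2 * ∫ x, inner ℝ (weakGrad u x) (gradient h x)) +
        s ^ 2 * ∫ x, ‖gradient h x‖ ^ 2 := by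
    have hw := (hu.isWeakGradient.add_smul (isWeakGradient_gradient ht.1 ht.2.1) 1 s).weakGrad_ae_eq
    simp only [one_mul, one_smul] at hw
    have hae : (fun x => ‖weakGrad (fun x => u x + s * η ‖x‖) x‖ ^ 2) =ᵐ[volume] fun x =>
        ‖weakGrad u x‖ ^ 2 + s * (2 * inner ℝ (weakGrad u x) (gradient h x)) +
          s ^ 2 * ‖gradient h x‖ ^ 2 := by
      filter_upwards [hw] with x hx
      rw [hx, norm_add_sq_real, inner_smul_right, norm_smul, mul_pow, Real.norm_eq_abs, sq_abs]
      ring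
    have i13 := (i3.const_mul 2).const_mul s
    have s₁ := integral_add (i1.add i13) (i2.const_mul (s ^ 2))
    simp only [Pi.add_apply] at s₁
    rw [integral_congr_ae hae, s₁, integral_add i1 i13, integral_const_mul, integral_const_mul,
      integral_const_mul]
  simp only [e]
  have hk := hη.deriv_div
  -- The divergence identity with `k = η'/r`: in polar coordinates the density is `r^(N-1) (N k + r
  -- k') = (r^N k)' = (r^(N-1) η')'`.
  have hflux : ∫ x, inner ℝ (weakGrad u x) (gradient h x) =
      -(sphereConst N * ∫ r, U r * deriv (fun r => r ^ (N - 1) * deriv η r) r) := by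
    have h1 := hu.isWeakGradient.integral_radial_field hk
    have h2 : (fun x => u x * (N * (deriv η ‖x‖ / ‖x‖) +
        ‖x‖ * deriv (fun r => deriv η r / r) ‖x‖)) =ᵐ[volume] fun x =>
          (fun r => U r * (N * (deriv η r / r) + r * deriv (fun r => deriv η r / r) r)) ‖x‖ := by
      filter_upwards [huU] with x hx
      rw [hx]
    rw [integral_congr_ae h2, integral_comp_norm hN
      fun r => U r * (N * (deriv η r / r) + r * deriv (fun r => deriv η r / r) r)] at h1
    have h3 (x) : inner ℝ (weakGrad u x) (gradient h x) =
        inner ℝ ((deriv η ‖x‖ / ‖x‖) • x) (weakGrad u x) := by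
      rw [hη.gradient_comp_norm, real_inner_comm]
    simp only [h3]
    rw [← neg_eq_iff_eq_neg.2 h1]
    congr 2
    have hA := (hη.deriv.smul_contDiffAt (q := fun r => r ^ (N - 1))
      fun r _ => (contDiff_id.pow _).contDiffAt).deriv
    rw [← hA.setIntegral_Ioi]
    refine setIntegral_congr_fun measurableSet_Ioi fun r hr => ?_
    have hr0 : r ≠ 0 := (mem_Ioi.1 hr).ne'
    have h4 : (fun r => r ^ (N - 1) * deriv η r) =ᶠ[𝓝 r] fun r => r ^ N * (deriv η r / r) := by
      filter_upwards [isOpen_ne.mem_nhds hr0] with s hs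
      rw [← Nat.sub_add_cancel (Nat.succ_le_of_lt hN), pow_succ]
      have : s ≠ 0 := hs
      simp only [Nat.succ_eq_add_one, zero_add, add_tsub_cancel_right]
      field_simp
    have h5 : HasDerivAt (fun r => r ^ N * (deriv η r / r))
        (N * r ^ (N - 1) * (deriv η r / r) + r ^ N * deriv (fun r => deriv η r / r) r) r :=
      (hasDerivAt_pow N r).mul (hk.differentiable r).hasDerivAt
    rw [h4.deriv_eq, h5.deriv]
    have h6 : r ^ N = r ^ (N - 1) * r := by
      rw [← pow_succ, Nat.sub_add_cancel (Nat.succ_le_of_lt hN)]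
    rw [h6]
    ring
  rw [hflux]
  have h7 (A B C : ℝ) : HasDerivAt (fun s : ℝ => A + s * B + s ^ 2 * C) B 0 := by
    have := (((hasDerivAt_id (0 : ℝ)).mul_const B).const_add A).fun_add
      ((hasDerivAt_pow 2 (0 : ℝ)).mul_const C)
    simpa using this
  exact (h7 _ _ _).congr_deriv (by ring)

/-! ### Finiteness of the potential and nonlinear terms -/

theorem integrable_modular (hN : 0 < N) (hV : ∀ r, 0 < r → 0 ≤ V r)
    (hVc : ContinuousOn V (Ioi 0)) (hU : ContinuousOn U (Ioi 0))
    (huU : u =ᵐ[volume] fun x => U ‖x‖) (hu : modular V u < ⊤) :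
    Integrable fun x : EuclideanSpace ℝ (Fin N) => V ‖x‖ * f (U ‖x‖) ^ 2 := by
  have hm := aestronglyMeasurable_comp_norm hN (F := fun r => V r * f (U r) ^ 2)
    (hVc.mul ((continuous_f.comp_continuousOn hU).pow 2))
  rw [← lintegral_ofReal_ne_top_iff_integrable hm]
  · refine ne_of_lt (lt_of_eq_of_lt (lintegral_congr_ae ?_) hu)
    filter_upwards [huU] with x hx
    rw [hx]
  · filter_upwards [ae_ne_zero hN] with x hx
    exact mul_nonneg (hV _ (norm_pos_iff.2 hx)) (sq_nonneg _)

theorem hasDerivAt_primG (hg : Continuous g) (t : ℝ) : HasDerivAt (primG g) (g t) t :=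
  intervalIntegral.integral_hasDerivAt_right (hg.intervalIntegrable _ _)
    (hg.stronglyMeasurableAtFilter _ _) hg.continuousAt

theorem primG_nonneg (hg₁ : HypG1 g) (t : ℝ) : 0 ≤ primG g t := by
  obtain ⟨θ, hθ, h⟩ := hg₁
  nlinarith [(h t).1]

/-- Since `G ≥ 0` and `2θ > 1`, `HypG1` gives `G(t) ≤ g(t) t`, so the growth bound on `g` passes to
`G` without integration. -/
theorem exists_primG_le (hg₁ : HypG1 g) {q₁ q₂ : ℝ} (hq₁ : 1 < q₁) (hq₂ : 1 < q₂)
    (hgq : HypGq g q₁ q₂) :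
    ∃ C, 0 ≤ C ∧ ∀ t, primG g t ≤ C * |t| ^ q₁ ∧ primG g t ≤ C * |t| ^ q₂ := by
  obtain ⟨θ, hθ, h⟩ := id hg₁
  obtain ⟨C, hC, hb⟩ := hgq
  have key (q : ℝ) (hq : 1 < q) (t : ℝ) (ht : |g t| ≤ C * |t| ^ (q - 1)) :
      primG g t ≤ C * |t| ^ q := by
    have h1 : primG g t ≤ g t * t := by nlinarith [(h t).2, primG_nonneg hg₁ t]
    have h2 : g t * t ≤ |g t| * |t| := (le_abs_self _).trans_eq (abs_mul _ _)
    have h3 : |t| ^ q = |t| ^ (q - 1) * |t| := by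
      rcases eq_or_ne t 0 with rfl | h0
      · simp [Real.zero_rpow (by linarith : q ≠ 0)]
      · rw [← Real.rpow_add_one (abs_pos.2 h0).ne', sub_add_cancel]
    rw [h3, ← mul_assoc]
    exact h1.trans (h2.trans (mul_le_mul_of_nonneg_right ht (abs_nonneg t)))
  refine ⟨C, hC.le, fun t => ⟨key q₁ hq₁ t ((hb t).trans ?_), key q₂ hq₂ t ((hb t).trans ?_)⟩⟩
  · exact mul_le_mul_of_nonneg_left (min_le_left _ _) hC.le
  · exact mul_le_mul_of_nonneg_left (min_le_right _ _) hC.le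

/-- The nonlinear term of the energy is finite on `E`. -/
theorem integrable_primG (hN : 3 ≤ N) (hH : HypH V K) (hg : Continuous g) {q₁ q₂ : ℝ}
    (hq₁ : 1 < q₁) (hq₂ : 1 < q₂) (hg₁ : HypG1 g) (hgq : HypGq g q₁ q₂)
    (hS : CondS' N V K q₁ q₂) (hU : ContinuousOn U (Ioi 0))
    (huU : u =ᵐ[volume] fun x => U ‖x‖) (hu : MemE V u)
    (hzero : weakGrad u =ᵐ[volume] 0 → ∀ r, 0 < r → U r = 0) :
    Integrable fun x : EuclideanSpace ℝ (Fin N) => K ‖x‖ * primG g (f (U ‖x‖)) := by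
  have hN0 : 0 < N := by omega
  obtain ⟨-, hV, hKc, hK, -⟩ := hH
  obtain ⟨R₁, R₂, hR₁, hR₂, hS₁, hS₂⟩ := hS
  obtain ⟨C, hC, hG⟩ := exists_primG_le hg₁ hq₁ hq₂ hgq
  have hGc : Continuous (primG g) :=
    continuous_iff_continuousAt.2 fun t => (hasDerivAt_primG hg t).continuousAt
  have hF : ContinuousOn (fun r => K r * primG g (f (U r))) (Ioi 0) :=
    hKc.mul (hGc.comp_continuousOn (continuous_f.comp_continuousOn hU))
  have hm := aestronglyMeasurable_comp_norm hN0 hF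
  have hnn : 0 ≤ normE V u := add_nonneg (Real.sqrt_nonneg _) ENNReal.toReal_nonneg
  rcases hnn.eq_or_lt with h0 | hpos
  · have hz := hzero (weakGrad_ae_eq_zero_of_normE_eq_zero hu.1 h0.symm)
    refine (integrable_zero _ ℝ volume).congr ?_
    filter_upwards [ae_ne_zero hN0] with x hx
    simp [hz _ (norm_pos_iff.2 hx), f_zero, primG]
  have key (s : Set (EuclideanSpace ℝ (Fin N))) (q : ℝ) (hq : 0 ≤ q)
      (hGq : ∀ t, primG g t ≤ C * |t| ^ q)
      (hfin : ∫⁻ x in s, ENNReal.ofReal (K ‖x‖ * |u x| ^ q) < ⊤) :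
      IntegrableOn (fun x : EuclideanSpace ℝ (Fin N) => K ‖x‖ * primG g (f (U ‖x‖))) s := by
    refine ⟨hm.restrict, ?_⟩
    rw [hasFiniteIntegral_iff_enorm]
    refine lt_of_le_of_lt ?_ (ENNReal.mul_lt_top (ENNReal.ofReal_lt_top (r := C)) hfin)
    rw [← lintegral_const_mul' _ _ ENNReal.ofReal_ne_top]
    refine lintegral_mono_ae (ae_restrict_of_ae ?_)
    filter_upwards [huU, ae_ne_zero hN0] with x hx hx0
    have hKx := hK _ (norm_pos_iff.2 hx0)
    rw [← ENNReal.ofReal_mul hC, Real.enorm_eq_ofReal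
      (mul_nonneg hKx.le (primG_nonneg hg₁ _)), hx]
    refine ENNReal.ofReal_le_ofReal ?_
    have h1 : |f (U ‖x‖)| ^ q ≤ |U ‖x‖| ^ q :=
      Real.rpow_le_rpow (abs_nonneg _) (abs_f_le _) hq
    calc K ‖x‖ * primG g (f (U ‖x‖)) ≤ K ‖x‖ * (C * |U ‖x‖| ^ q) :=
          mul_le_mul_of_nonneg_left
            ((hGq _).trans (mul_le_mul_of_nonneg_left h1 hC)) hKx.le
      _ = C * (K ‖x‖ * |U ‖x‖| ^ q) := by ring
  have k1 := key _ q₁ (by linarith) (fun t => (hG t).1)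
    (lintegral_rpow_lt_top_of_unit hN0 hV _ hS₁ hu hpos)
  have k2 := key _ q₂ (by linarith) (fun t => (hG t).2)
    (lintegral_rpow_lt_top_of_unit hN0 hV _ hS₂ hu hpos)
  -- The two suprema leave uncovered at most an annulus, on which the integrand is continuous up to
  -- the boundary.
  have k3 : IntegrableOn (fun x : EuclideanSpace ℝ (Fin N) => K ‖x‖ * primG g (f (U ‖x‖)))
      (Metric.closedBall 0 R₂ ∩ {x | R₁ ≤ ‖x‖}) := by
    refine ContinuousOn.integrableOn_compact
      ((isCompact_closedBall _ _).inter_right (isClosed_le continuous_const continuous_norm)) ?_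
    exact hF.comp continuous_norm.continuousOn fun x hx => hR₁.trans_le hx.2
  rw [← integrableOn_univ]
  refine ((k1.union k2).union k3).mono_set fun x _ => ?_
  simp only [mem_union, mem_compl_iff, mem_ball_zero_iff, mem_inter_iff, mem_closedBall_zero_iff,
    mem_ofPred_eq, not_lt]
  rcases lt_or_ge ‖x‖ R₁ with h | h
  · exact Or.inl (Or.inl h)
  · rcases le_total R₂ ‖x‖ with h' | h'
    · exact Or.inl (Or.inr h')
    · exact Or.inr ⟨h', h⟩

/-! ### From criticality to the weak radial equation -/

/-- Along `s h` with `s > 0`, homogeneity turns the Fréchet condition into a bound `ε ‖h‖` on the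
difference quotients. Right-hand quotients suffice because `D` is assumed to be the two-sided
derivative. -/
theorem IsCriticalPoint.deriv_eq_zero (hu : IsCriticalPoint V K g u)
    {h : EuclideanSpace ℝ (Fin N) → ℝ} (hh : ∀ s : ℝ, 0 < s → MemE V fun x => s * h x) {D : ℝ}
    (hD : HasDerivAt (fun s : ℝ => energy V K g fun x => u x + s * h x) D 0) : D = 0 := by
  have hh1 : MemE V h := by simpa using hh 1 one_pos
  have hn : 0 ≤ normE V h := add_nonneg (Real.sqrt_nonneg _) ENNReal.toReal_nonneg
  have key (ε : ℝ) (hε : 0 < ε) : |D| ≤ ε * normE V h := by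
    obtain ⟨δ, hδ, hb⟩ := hu.2 ε hε
    have ht := (hasDerivAt_iff_tendsto_slope.1 hD).mono_left
      (nhdsWithin_mono (0 : ℝ) (show Ioi (0 : ℝ) ⊆ {0}ᶜ from fun s hs => (ne_of_gt hs)))
    refine le_of_tendsto ht.abs ?_
    have hs : Tendsto (fun s : ℝ => s * normE V h) (𝓝[>] 0) (𝓝 0) := by
      have : Tendsto (fun s : ℝ => s * normE V h) (𝓝 0) (𝓝 (0 * normE V h)) :=
        (continuous_id.mul continuous_const).tendsto 0
      rw [zero_mul] at this
      exact this.mono_left nhdsWithin_le_nhds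
    filter_upwards [hs.eventually_lt_const hδ, self_mem_nhdsWithin] with s hs hs0
    have hs0 : 0 < s := hs0
    have hE := normE_const_mul (V := V) hh1.1 hs0
    have h1 := hb _ (hh s hs0) (by rw [hE]; exact hs)
    rw [hE] at h1
    have e0 : (fun x => u x + 0 * h x) = u := by funext x; ring
    rw [slope_def_field, sub_zero, e0, abs_div, abs_of_pos hs0, div_le_iff₀ hs0]
    linarith
  have h1 : |D| ≤ 0 := by
    refine le_of_forall_pos_le_add fun ε hε => ?_
    -- The `+ 1` covers the possibility that `normE V h` is zero.
    have h2 := key (ε / (normE V h + 1)) (by positivity)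
    have h3 : ε / (normE V h + 1) * normE V h ≤ ε := by
      rw [div_mul_eq_mul_div, div_le_iff₀ (by positivity)]
      nlinarith
    linarith
  exact abs_nonpos_iff.1 h1

/-- The profile of a critical point is a weak solution of the radial equation. -/
theorem IsCriticalPoint.weak_ode (hN : 3 ≤ N) (hH : HypH V K) (hg : Continuous g) {q₁ q₂ : ℝ}
    (hq₁ : 1 < q₁) (hq₂ : 1 < q₂) (hg₁ : HypG1 g) (hgq : HypGq g q₁ q₂)
    (hS : CondS' N V K q₁ q₂) (hu : IsCriticalPoint V K g u) (hU : ContinuousOn U (Ioi 0))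
    (huU : u =ᵐ[volume] fun x => U ‖x‖)
    (hzero : weakGrad u =ᵐ[volume] 0 → ∀ r, 0 < r → U r = 0) (hη : RayTest η) :
    ∫ r, U r * deriv (fun r => r ^ (N - 1) * deriv η r) r =
      ∫ r, r ^ (N - 1) * ((V r * f (U r) - K r * g (f (U r))) * deriv f (U r)) * η r := by
  have hN0 : 0 < N := by omega
  obtain ⟨hVc, hV, hKc, hK, -⟩ := id hH
  have hf (t : ℝ) : HasDerivAt f (deriv f t) t := (hasDerivAt_f t).differentiableAt.hasDerivAt
  have d1 := hasDerivAt_dirichlet hN0 hu.1.1 huU hη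
  have d2 := hasDerivAt_integral_superposition hN0 hVc hU hη (H := fun t => f t ^ 2)
    (H' := fun t => 2 * f t * deriv f t) (fun t => by simpa using (hf t).fun_pow 2)
    ((continuous_const.mul continuous_f).mul continuous_deriv_f)
    (integrable_modular hN0 hV hVc hU huU hu.1.2)
  have d3 := hasDerivAt_integral_superposition hN0 hKc hU hη (H := fun t => primG g (f t))
    (H' := fun t => g (f t) * deriv f t)
    (fun t => (hasDerivAt_primG hg (f t)).comp t (hf t))
    ((hg.comp continuous_f).mul continuous_deriv_f)
    (integrable_primG hN hH hg hq₁ hq₂ hg₁ hgq hS hU huU hu.1 hzero)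
  have e (s : ℝ) : energy V K g (fun x => u x + s * η ‖x‖) =
      1 / 2 * (∫ x, ‖weakGrad (fun x => u x + s * η ‖x‖) x‖ ^ 2) +
        1 / 2 * (∫ x : EuclideanSpace ℝ (Fin N), V ‖x‖ * f (U ‖x‖ + s * η ‖x‖) ^ 2) -
        ∫ x : EuclideanSpace ℝ (Fin N), K ‖x‖ * primG g (f (U ‖x‖ + s * η ‖x‖)) := by
    have e₁ : ∫ x, V ‖x‖ * f (u x + s * η ‖x‖) ^ 2 =
        ∫ x : EuclideanSpace ℝ (Fin N), V ‖x‖ * f (U ‖x‖ + s * η ‖x‖) ^ 2 := by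
      refine integral_congr_ae ?_
      filter_upwards [huU] with x hx
      rw [hx]
    have e₂ : ∫ x, K ‖x‖ * primG g (f (u x + s * η ‖x‖)) =
        ∫ x : EuclideanSpace ℝ (Fin N), K ‖x‖ * primG g (f (U ‖x‖ + s * η ‖x‖)) := by
      refine integral_congr_ae ?_
      filter_upwards [huU] with x hx
      rw [hx]
    rw [energy, e₁, e₂]
  have hD := ((d1.const_mul (1 / 2)).add (d2.const_mul (1 / 2))).sub d3
  have h0 := hu.deriv_eq_zero (h := fun x => η ‖x‖)
    (fun s _ => (hη.const_mul s).memE hN0 hV hVc)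
    (hD.congr_of_eventuallyEq (Eventually.of_forall e))
  have hp : ContinuousOn (fun r : ℝ => r ^ (N - 1)) (Ioi 0) := by fun_prop
  have hfU := continuous_f.comp_continuousOn hU
  have hfU' := continuous_deriv_f.comp_continuousOn hU
  have i2 := hη.integrable_mul (hp.mul (hVc.mul ((continuousOn_const (c := 2).mul hfU).mul hfU')))
  have i3 := hη.integrable_mul (hp.mul (hKc.mul ((hg.comp_continuousOn hfU).mul hfU')))
  have e2 (r : ℝ) :
      r ^ (N - 1) * ((V r * f (U r) - K r * g (f (U r))) * deriv f (U r)) * η r =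
      1 / 2 * (r ^ (N - 1) * (V r * (2 * f (U r) * deriv f (U r))) * η r) -
        r ^ (N - 1) * (K r * (g (f (U r)) * deriv f (U r))) * η r := by ring
  have e3 : ∫ r, r ^ (N - 1) * ((V r * f (U r) - K r * g (f (U r))) * deriv f (U r)) * η r =
      1 / 2 * (∫ r, r ^ (N - 1) * (V r * (2 * f (U r) * deriv f (U r))) * η r) -
        ∫ r, r ^ (N - 1) * (K r * (g (f (U r)) * deriv f (U r))) * η r := by
    simp only [e2]
    rw [← integral_const_mul]
    exact integral_sub (i2.const_mul _) i3
  rw [e3]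
  have hc := (sphereConst_pos hN0).ne'
  apply mul_left_cancel₀ hc
  linarith

/-! ### Classical regularity -/

theorem contDiffAt_two_of_hasDerivAt {W W₁ W₂ : ℝ → ℝ}
    (h : ∀ r, 0 < r → HasDerivAt W (W₁ r) r) (h₁ : ∀ r, 0 < r → HasDerivAt W₁ (W₂ r) r)
    (h₂ : ContinuousOn W₂ (Ioi 0)) {r : ℝ} (hr : 0 < r) : ContDiffAt ℝ 2 W r := by
  have e₁ : ContDiffOn ℝ 1 W₁ (Ioi 0) := by
    rw [show (1 : WithTop ℕ∞) = 0 + 1 by norm_num, contDiffOn_succ_iff_deriv_of_isOpen isOpen_Ioi]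
    refine ⟨fun r hr => (h₁ r hr).differentiableAt.differentiableWithinAt, by simp, ?_⟩
    rw [contDiffOn_zero]
    exact h₂.congr fun r hr => (h₁ r hr).deriv
  have e : ContDiffOn ℝ 2 W (Ioi 0) := by
    rw [show (2 : WithTop ℕ∞) = 1 + 1 by norm_num, contDiffOn_succ_iff_deriv_of_isOpen isOpen_Ioi]
    exact ⟨fun r hr => (h r hr).differentiableAt.differentiableWithinAt, by simp,
      e₁.congr fun r hr => (h r hr).deriv⟩
  exact e.contDiffAt (Ioi_mem_nhds hr)

/-- A classical solution of the radial dual equation gives one of the quasilinear equation. -/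
theorem isClassicalSolution_of_radial_ode (hVc : ContinuousOn V (Ioi 0))
    (hKc : ContinuousOn K (Ioi 0)) (hg : Continuous g) {P : ℝ → ℝ} (hN : 0 < N)
    (h : ∀ r, 0 < r → HasDerivAt U (P r) r ∧
      HasDerivAt P ((V r * f (U r) - K r * g (f (U r))) * deriv f (U r) - (N - 1 : ℕ) / r * P r) r) :
    IsClassicalSolution V K g fun x : EuclideanSpace ℝ (Fin N) => f (U ‖x‖) := by
  have hU : ContinuousOn U (Ioi 0) := fun r hr => (h r hr).1.continuousAt.continuousWithinAt
  have hP : ContinuousOn P (Ioi 0) := fun r hr => (h r hr).2.continuousAt.continuousWithinAt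
  let B : ℝ → ℝ := fun r => (V r * f (U r) - K r * g (f (U r))) * deriv f (U r)
  let W : ℝ → ℝ := fun r => f (U r)
  let W₁ : ℝ → ℝ := fun r => deriv f (U r) * P r
  let W₂ : ℝ → ℝ := fun r => -(2 * f (U r)) / (1 + 2 * f (U r) ^ 2) ^ 2 * P r * P r +
    deriv f (U r) * (B r - (N - 1 : ℕ) / r * P r)
  have hW (r : ℝ) (hr : 0 < r) : HasDerivAt W (W₁ r) r :=
    (hasDerivAt_f (U r)).differentiableAt.hasDerivAt.comp r (h r hr).1
  have hW₁ (r : ℝ) (hr : 0 < r) : HasDerivAt W₁ (W₂ r) r :=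
    ((hasDerivAt_deriv_f (U r)).comp r (h r hr).1).mul (h r hr).2
  have hfU := continuous_f.comp_continuousOn hU
  have hfU' := continuous_deriv_f.comp_continuousOn hU
  have hW₂ : ContinuousOn W₂ (Ioi 0) := by
    have hB : ContinuousOn B (Ioi 0) :=
      ((hVc.mul hfU).sub (hKc.mul (hg.comp_continuousOn hfU))).mul hfU'
    have hp (s : ℝ) : 0 < 1 + 2 * f s ^ 2 := by positivity
    refine ((ContinuousOn.mul (ContinuousOn.div (continuousOn_const.mul hfU).neg
      ((continuousOn_const.add (continuousOn_const.mul (hfU.pow 2))).pow 2)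
      fun r _ => (pow_pos (hp _) 2).ne') hP).mul hP).add (hfU'.mul (hB.sub ((continuousOn_const.div continuousOn_id
        fun r hr => (mem_Ioi.1 hr).ne').mul hP)))
  refine ⟨fun x hx => ?_, fun x hx => ?_⟩
  · exact (contDiffAt_comp_norm hx (contDiffAt_two_of_hasDerivAt hW hW₁ hW₂
      (norm_pos_iff.2 hx))).contDiffWithinAt
  · have hr : 0 < ‖x‖ := norm_pos_iff.2 hx
    have hl := laplacian_comp_norm hx hW (hW₁ _ hr)
    have hl2 := laplacian_comp_norm (Φ := fun r => W r ^ 2) (Φ₁ := fun r => 2 * W r * W₁ r) hx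
      (fun r hr => by simpa using (hW r hr).fun_pow 2) (((hW _ hr).const_mul 2).mul (hW₁ _ hr))
    simp only [W] at hl hl2
    -- With `d² = 1 + 2w²`, the left side is `-d² Δw - 2w |∇w|² + V w`. Since `f' = 1/d` and `f'' =
    -- -2w/d⁴`, the `f''` part of `d² Δw` is `-2w P²/d²`, which cancels the term in `|∇w|² = P²/d²`.
    -- What is left is `-d B + V w = K g(w)`.
    rw [hl, hl2]
    simp only [W₁, W₂, B, deriv_f]
    set r := ‖x‖
    set w := f (U r)
    have hp : 0 < 1 + 2 * w ^ 2 := by positivity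
    have hs := Real.sq_sqrt hp.le
    have hs0 := (sqrt_pos' w).ne'
    set d := √(1 + 2 * w ^ 2)
    have hNr : ((N - 1 : ℕ) : ℝ) = N - 1 := by
      rw [Nat.cast_sub (Nat.succ_le_of_lt hN)]; simp
    rw [hNr, ← hs]
    field_simp
    linear_combination (-2 * w * P r ^ 2 * r + w * r * d ^ 2 * V r - r * d ^ 2 * K r * g w) * hs

end

end QuasilinearDual

end

/-! ### Assembly of the theorem -/

theorem theorem6p3 (N : ℕ) (hN : 3 ≤ N) (V K : ℝ → ℝ) (hH : QuasilinearDual.HypH V K)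
    (g : ℝ → ℝ) (hg : Continuous g) (q₁ q₂ : ℝ) (hq₁ : 1 < q₁) (hq₂ : 1 < q₂)
    (hg₁ : QuasilinearDual.HypG1 g) (hg₂ : QuasilinearDual.HypG2 g)
    (hgq : QuasilinearDual.HypGq g q₁ q₂)
    (hS : QuasilinearDual.CondS' N V K q₁ q₂)
    (u : EuclideanSpace ℝ (Fin N) → ℝ) (hu : QuasilinearDual.IsCriticalPoint V K g u) :
    ∃ w : EuclideanSpace ℝ (Fin N) → ℝ,
      w =ᵐ[volume] (fun x => QuasilinearDual.f (u x)) ∧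
      ContDiffOn ℝ 2 w {0}ᶜ ∧
      QuasilinearDual.IsClassicalSolution V K g w := by
  obtain ⟨U, hU, huU, hzero⟩ := hu.1.1.exists_continuousOn_profile hN
  have hfU := QuasilinearDual.continuous_f.comp_continuousOn hU
  obtain ⟨P, hP⟩ := QuasilinearDual.exists_hasDerivAt_of_weak_ode (N - 1) hU
    (((hH.1.mul hfU).sub (hH.2.2.1.mul (hg.comp_continuousOn hfU))).mul
      (QuasilinearDual.continuous_deriv_f.comp_continuousOn hU))
    fun η hη => hu.weak_ode hN hH hg hq₁ hq₂ hg₁ hgq hS hU huU hzero hη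
  have hw := QuasilinearDual.isClassicalSolution_of_radial_ode hH.1 hH.2.2.1 hg (by omega) hP
  refine ⟨fun x => QuasilinearDual.f (U ‖x‖), ?_, hw.1, hw⟩
  filter_upwards [huU] with x hx
  rw [hx]
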